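/- Let $n\in\mathbb{N}$, $T>0$, let $H_0,H_1\in\mathfrak{su}(n)$ (traceless skew-Hermitian $n\times n$ matrices), and let $\rho_0,\theta$ be Hermitian $n\times n$ matrices. For $u\in\mathcal H:=L^2([0,T],\mathbb{R})$ let $\rho(\cdot)$ and $U(\cdot)$ be the absolutely continuous (Carathéodory) solutions on $[0,T]$ of $$\dot\rho=[H_0+u(t)H_1,\rho],\ \rho(0)=\rho_0,\qquad \dot U=(H_0+u(t)H_1)U,\ U(0)=\mathrm{Id}.$$ Put $\mathrm{End}_{\rho_0}(u):=\rho(T)$, which lies in $\mathcal O(\rho_0):=\{U\rho_0U^\dagger: U\in \mathrm{SU}(n)\}$, and $J(\rho):=\mathrm{Re}\,\mathrm{tr}(\rho\theta)$, $\mathcal J(u):=J(\mathrm{End}_{\rho_0}(u))$. For $\rho\in\mathcal O(\rho_0)$ equip the tangent space $T_\rho\mathcal O(\rho_0)=\{[\rho,\Omega]:\Omega\in\mathfrak{su}(n)\}$ with the inner product $\langle[\rho,\Omega_1],[\rho,\Omega_2]\rangle_\rho:=\mathrm{tr}\big((\Omega_1^{\mathfrak p_\rho})^\dagger\,\Omega_2^{\mathfrak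 p_\rho}\big)$, where $\Omega^{\mathfrak p_\rho}$ is the Hilbert–Schmidt orthogonal projection of $\Omega$ onto the orthogonal complement $\mathfrak p_\rho$ of $\{\Omega\in\mathfrak{su}(n):[\rho,\Omega]=0\}$ in $\mathfrak{su}(n)$. Let $\nabla J$ be the gradient of $J$ on $\mathcal O(\rho_0)$ for this metric, let $d\mathrm{End}_{\rho_0}(u):\mathcal H\to T_{\rho(T)}\mathcal O(\rho_0)$ be the Fréchet differential of $\mathrm{End}_{\rho_0}$ at $u$, and let $d\mathrm{End}^*_{\rho_0}(u)$ be its adjoint. For $z\in T_{\rho(T)}\mathcal O(\rho_0)$ let $q(\cdot)$, with $q(t)\in T_{\rho(t)}\mathcal O(\rho_0)$, be the solution on $[0,T]$ of $\dot q=[H_0+u(t)H_1,q]$, $q(T)=z$, and define the switching function $\Phi_{\rho_0,z}(t):=\langle q(t),[H_1,\rho(t)]\rangle_{\rho(t)}$. Then, for every $u\in\mathcal H$, the objects above exist and are uniquely determined by $u$ (and $z$), and the following are equivalent: 1. $u$ is a critical point of $\mathcal J$, i.e. $\mathcal J$ is differentiable at $u$ and $\nabla\mathcal J(u)=0$; 2.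 $\nabla J(\mathrm{End}_{\rho_0}(u))\in\mathrm{Ker}\,(d\mathrm{End}^*_{\rho_0}(u))$; 3. $\nabla J(\mathrm{End}_{\rho_0}(u))$ is orthogonal to the image of $d\mathrm{End}_{\rho_0}(u)$ with respect to $\langle\cdot,\cdot\rangle_{\mathrm{End}_{\rho_0}(u)}$; 4. the switching function $\Phi_{\rho_0,\nabla J(\mathrm{End}_{\rho_0}(u))}$ vanishes almost everywhere on $[0,T]$; 5. $\mathrm{tr}\big([\rho_0,U(T)^\dagger\theta U(T)]\,U(t)^\dagger H_1U(t)\big)=0$ for all $t\in[0,T]$; 6. $\mathrm{tr}\big([\rho(T),\theta]\,V(t)^\dagger H_1V(t)\big)=0$ for all $t\in[0,T]$, where $V(t):=U(t)U(T)^\dagger$ is the propagator from time $T$ to time $t$. -/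

import Mathlib

open MeasureTheory Set
open scoped Matrix ENNReal

namespace QuantumControl

/-- Complex `n × n` matrices, with their usual (entrywise) topology. -/
abbrev Mat (n : ℕ) := Matrix (Fin n) (Fin n) ℂ

/-! ### Traceless skew-Hermitian matrices and the unitary orbit -/

/-- `𝔰𝔲(n)`: traceless skew-Hermitian matrices, as a real vector space. -/
noncomputable def su (n : ℕ) : Submodule ℝ (Mat n) where
  carrier := {A | Aᴴ = -A ∧ A.trace = 0}
  add_mem' := by
    rintro A B ⟨hA, hA'⟩ ⟨hB, hB'⟩
    exact ⟨by rw [Matrix.conjTranspose_add, hA, hB, neg_add], by simp [hA', hB']⟩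
  zero_mem' := by simp
  smul_mem' := by
    rintro c A ⟨hA, hA'⟩
    exact ⟨by rw [Matrix.conjTranspose_smul, hA]; simp, by simp [hA']⟩

/-- The unitary orbit `𝒪(ρ₀) = {U ρ₀ U† : U ∈ SU(n)}`. -/
def orbit {n : ℕ} (ρ₀ : Mat n) : Set (Mat n) :=
  {ρ | ∃ U ∈ Matrix.specialUnitaryGroup (Fin n) ℂ, ρ = U * ρ₀ * Uᴴ}

/-- `ad_ρ Ω = [ρ, Ω] = ρ Ω - Ω ρ`, as a real linear map in `Ω`. -/
noncomputable def ad {n : ℕ} (ρ : Mat n) : Mat n →ₗ[ℝ] Mat n :=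
  LinearMap.mulLeft ℝ ρ - LinearMap.mulRight ℝ ρ

lemma ad_apply {n : ℕ} (ρ Ω : Mat n) : ad ρ Ω = ⁅ρ, Ω⁆ := rfl

/-- The (real) Hilbert-Schmidt form `(A, B) ↦ Re tr(A† B)`. On `𝔰𝔲(n)` the trace `tr(A† B)` is
already real. -/
noncomputable def hs (n : ℕ) : LinearMap.BilinForm ℝ (Mat n) :=
  LinearMap.mk₂ ℝ (fun A B => (Aᴴ * B).trace.re)
    (by intros; simp [add_mul]) (by intros; simp)
    (by intros; simp [mul_add]) (by intros; simp)

lemma hs_apply {n : ℕ} (A B : Mat n) : hs n A B = (Aᴴ * B).trace.re := rfl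

lemma hs_self_eq {n : ℕ} (A : Mat n) : hs n A A = ∑ i, ∑ j, Complex.normSq (A j i) := by
  simp [hs_apply, Matrix.trace, Matrix.mul_apply, Complex.normSq_apply]

lemma hs_self_nonneg {n : ℕ} (A : Mat n) : 0 ≤ hs n A A := by
  rw [hs_self_eq]
  exact Finset.sum_nonneg fun i _ => Finset.sum_nonneg fun j _ => Complex.normSq_nonneg _

lemma eq_zero_of_hs_self {n : ℕ} {A : Mat n} (h : hs n A A = 0) : A = 0 := by
  rw [hs_self_eq, Finset.sum_eq_zero_iff_of_nonneg
    (fun i _ => Finset.sum_nonneg fun j _ => Complex.normSq_nonneg _)] at h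
  ext j i
  have h1 := h i (Finset.mem_univ i)
  rw [Finset.sum_eq_zero_iff_of_nonneg (fun j _ => Complex.normSq_nonneg _)] at h1
  simpa using h1 j (Finset.mem_univ j)

lemma hs_symm {n : ℕ} (A B : Mat n) : hs n A B = hs n B A := by
  simp only [hs_apply]
  rw [← Complex.conj_re, ← Complex.star_def, ← Matrix.trace_conjTranspose,
    Matrix.conjTranspose_mul, Matrix.conjTranspose_conjTranspose]

/-- `𝔥_ρ = {Ω ∈ 𝔰𝔲(n) : [ρ, Ω] = 0}`. -/
noncomputable def stab {n : ℕ} (ρ : Mat n) : Submodule ℝ (Mat n) := su n ⊓ LinearMap.ker (ad ρ)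

/-- `𝔭_ρ`, the Hilbert-Schmidt orthogonal complement of `𝔥_ρ` in `𝔰𝔲(n)`. -/
noncomputable def pSpace {n : ℕ} (ρ : Mat n) : Submodule ℝ (Mat n) where
  carrier := {Ω | Ω ∈ su n ∧ ∀ Ω' ∈ stab ρ, hs n Ω Ω' = 0}
  add_mem' := by
    rintro A B ⟨hA, hA'⟩ ⟨hB, hB'⟩
    exact ⟨add_mem hA hB, fun Ω' h => by simp [hA' Ω' h, hB' Ω' h]⟩
  zero_mem' := ⟨zero_mem _, fun Ω' _ => by simp⟩
  smul_mem' := by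
    rintro c A ⟨hA, hA'⟩
    exact ⟨(su n).smul_mem c hA, fun Ω' h => by simp [hA' Ω' h]⟩

/-- `T_ρ 𝒪 = ad_ρ 𝔰𝔲(n)`, as a subspace of the space of matrices. -/
noncomputable def tangentSubmodule {n : ℕ} (ρ : Mat n) : Submodule ℝ (Mat n) := (su n).map (ad ρ)

/-- Equivariance `𝔭_{U ρ U†} = U 𝔭_ρ U†`: on the orbit of `ρ₀`, the spaces `𝔭_ρ` are the
translates of `𝔭_{ρ₀}`. -/
lemma conj_mem_pSpace {n : ℕ} {U : Mat n} (hU : Uᴴ * U = 1) (ρ : Mat n) {Ω : Mat n}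
    (hΩ : Ω ∈ pSpace ρ) : U * Ω * Uᴴ ∈ pSpace (U * ρ * Uᴴ) := by
  have hU' : U * Uᴴ = 1 := mul_eq_one_comm.1 hU
  have hconj : ∀ {V A : Mat n}, Vᴴ * V = 1 → A ∈ su n → V * A * Vᴴ ∈ su n := by
    rintro V A hV ⟨h1, h2⟩
    refine ⟨by simp [h1, mul_assoc], ?_⟩
    rw [Matrix.trace_mul_comm, ← mul_assoc, hV, one_mul, h2]
  refine ⟨hconj hU hΩ.1, ?_⟩
  rintro Ω' ⟨h1, h2⟩
  have h3 : Uᴴ * Ω' * U ∈ stab ρ := by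
    refine ⟨by simpa using hconj (V := Uᴴ) (by simpa using hU') h1, ?_⟩
    have h2' : U * ρ * Uᴴ * Ω' - Ω' * (U * ρ * Uᴴ) = 0 := h2
    have h4 : ρ * (Uᴴ * Ω' * U) - Uᴴ * Ω' * U * ρ
        = Uᴴ * (U * ρ * Uᴴ * Ω' - Ω' * (U * ρ * Uᴴ)) * U := by
      simp only [mul_sub, sub_mul, mul_assoc, hU, mul_one]
      simp only [← mul_assoc, hU, one_mul]
    change ρ * (Uᴴ * Ω' * U) - Uᴴ * Ω' * U * ρ = 0
    rw [h4, h2']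
    simp
  have h5 := hΩ.2 _ h3
  rw [hs_apply] at h5 ⊢
  rw [← h5]
  congr 1
  simp only [Matrix.conjTranspose_mul, Matrix.conjTranspose_conjTranspose, mul_assoc]
  rw [Matrix.trace_mul_comm]
  simp only [mul_assoc]

/-- The decomposition `Ω = Ω^𝔥 + Ω^𝔭`. -/
lemma exists_decomp {n : ℕ} (ρ : Mat n) {Ω : Mat n} (hΩ : Ω ∈ su n) :
    ∃ a ∈ stab ρ, ∃ b ∈ pSpace ρ, a + b = Ω := by
  have hnd : ((hs n).restrict (stab ρ)).Nondegenerate := by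
    refine ⟨fun x hx => ?_, fun x hx => ?_⟩ <;>
      exact Subtype.ext (eq_zero_of_hs_self (hx x))
  have hrefl : (hs n).IsRefl := fun x y h => by rw [hs_symm]; exact h
  have hc := LinearMap.BilinForm.isCompl_orthogonal_of_restrict_nondegenerate hrefl hnd
  obtain ⟨a, ha, b, hb, hab⟩ := Submodule.mem_sup.1 (hc.sup_eq_top ▸ Submodule.mem_top (x := Ω))
  refine ⟨a, ha, b, ⟨?_, fun Ω' h => ?_⟩, hab⟩
  · have : b = Ω - a := by rw [← hab]; abel
    rw [this]
    exact sub_mem hΩ ha.1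
  · rw [hs_symm]
    exact hb Ω' h

/-- A type synonym for the tangent space `T_ρ 𝒪 = ad_ρ 𝔰𝔲(n)`, which will carry the invariant
Riemannian metric. -/
def TangentVec {n : ℕ} (ρ : Mat n) : Type := ↥(tangentSubmodule ρ)

noncomputable instance {n : ℕ} (ρ : Mat n) : AddCommGroup (TangentVec ρ) :=
  inferInstanceAs (AddCommGroup ↥(tangentSubmodule ρ))

noncomputable instance {n : ℕ} (ρ : Mat n) : Module ℝ (TangentVec ρ) :=
  inferInstanceAs (Module ℝ ↥(tangentSubmodule ρ))

instance {n : ℕ} (ρ : Mat n) : FiniteDimensional ℝ (TangentVec ρ) :=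
  inferInstanceAs (FiniteDimensional ℝ ↥(tangentSubmodule ρ))

/-- The inclusion `T_ρ 𝒪 → ℂ^{n × n}`. -/
noncomputable def inclLin {n : ℕ} (ρ : Mat n) : TangentVec ρ →ₗ[ℝ] Mat n := (tangentSubmodule ρ).subtype

/-- The tangent vector `ad_ρ Ω = [ρ, Ω]`, for `Ω ∈ 𝔰𝔲(n)`. -/
noncomputable def adTangent {n : ℕ} (ρ : Mat n) : su n →ₗ[ℝ] TangentVec ρ :=
  ((ad ρ).comp (su n).subtype).codRestrict (tangentSubmodule ρ)
    fun Ω => Submodule.mem_map_of_mem Ω.2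

lemma inclLin_adTangent {n : ℕ} (ρ : Mat n) (Ω : su n) :
    inclLin ρ (adTangent ρ Ω) = ⁅ρ, (Ω : Mat n)⁆ := rfl

/-- `ad_ρ` restricted to `𝔭_ρ`. -/
noncomputable def adP {n : ℕ} (ρ : Mat n) : pSpace ρ →ₗ[ℝ] TangentVec ρ :=
  (adTangent ρ).comp (Submodule.inclusion fun _ h => h.1)

lemma adP_bijective {n : ℕ} (ρ : Mat n) : Function.Bijective (adP ρ) := by
  constructor
  · rw [← LinearMap.ker_eq_bot, LinearMap.ker_eq_bot']
    rintro ⟨Ω, hΩ, hΩ'⟩ h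
    have h0 : ad ρ Ω = 0 := congrArg (inclLin ρ) h
    exact Subtype.ext (eq_zero_of_hs_self (hΩ' Ω ⟨hΩ, h0⟩))
  · rintro ⟨ξ, Ω, hΩ, rfl⟩
    obtain ⟨a, ha, b, hb, rfl⟩ := exists_decomp ρ hΩ
    refine ⟨⟨b, hb⟩, Subtype.ext ?_⟩
    have h0 : ad ρ a = 0 := ha.2
    change ad ρ b = ad ρ (a + b)
    rw [map_add, h0, zero_add]

/-- For a tangent vector `ξ = ad_ρ Ω`, `Ω ∈ 𝔰𝔲(n)`, the component `Ω^{𝔭_ρ}`. -/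
noncomputable def pLift {n : ℕ} (ρ : Mat n) : TangentVec ρ ≃ₗ[ℝ] pSpace ρ :=
  (LinearEquiv.ofBijective (adP ρ) (adP_bijective ρ)).symm

/-- The metric `⟨ad_ρ Ω₁, ad_ρ Ω₂⟩_ρ = tr((Ω₁^{𝔭_ρ})† Ω₂^{𝔭_ρ})`. -/
noncomputable instance metricCore {n : ℕ} (ρ : Mat n) :
    InnerProductSpace.Core ℝ (TangentVec ρ) where
  inner ξ η := hs n (pLift ρ ξ) (pLift ρ η)
  conj_inner_symm ξ η := hs_symm _ _
  re_inner_nonneg ξ := hs_self_nonneg _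
  add_left ξ η ζ := by simp
  smul_left ξ η r := by simp
  definite ξ h := by
    have h1 : ((pLift ρ ξ : pSpace ρ) : Mat n) = 0 := eq_zero_of_hs_self h
    exact (pLift ρ).map_eq_zero_iff.1 (Subtype.ext h1)

noncomputable instance {n : ℕ} (ρ : Mat n) : NormedAddCommGroup (TangentVec ρ) :=
  (metricCore ρ).toNormedAddCommGroup

noncomputable instance {n : ℕ} (ρ : Mat n) : InnerProductSpace ℝ (TangentVec ρ) :=
  InnerProductSpace.ofCore (metricCore ρ).toCore

instance {n : ℕ} (ρ : Mat n) : CompleteSpace (TangentVec ρ) :=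
  FiniteDimensional.complete ℝ _

/-- The explicit form of the metric: `aᵢ` and `bᵢ` are the components of `Ωᵢ` in `𝔥_ρ`
and in `𝔭_ρ`. -/
lemma inner_adTangent {n : ℕ} (ρ : Mat n) (Ω₁ Ω₂ : su n) {a₁ b₁ a₂ b₂ : Mat n}
    (ha₁ : a₁ ∈ stab ρ) (hb₁ : b₁ ∈ pSpace ρ) (h₁ : a₁ + b₁ = Ω₁)
    (ha₂ : a₂ ∈ stab ρ) (hb₂ : b₂ ∈ pSpace ρ) (h₂ : a₂ + b₂ = Ω₂) :
    inner ℝ (adTangent ρ Ω₁) (adTangent ρ Ω₂) = (b₁ᴴ * b₂).trace.re := by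
  have key : ∀ (Ω : su n) {a b : Mat n} (_ : a ∈ stab ρ) (hb : b ∈ pSpace ρ) (_ : a + b = Ω),
      pLift ρ (adTangent ρ Ω) = ⟨b, hb⟩ := by
    intro Ω a b ha hb h
    rw [pLift, LinearEquiv.symm_apply_eq]
    apply Subtype.ext
    have h0 : ad ρ a = 0 := ha.2
    change ad ρ Ω = ad ρ b
    rw [← h, map_add, h0, zero_add]
  change hs n (pLift ρ (adTangent ρ Ω₁)) (pLift ρ (adTangent ρ Ω₂)) = _
  rw [key Ω₁ ha₁ hb₁ h₁, key Ω₂ ha₂ hb₂ h₂, hs_apply]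

/-- The inclusion `T_ρ 𝒪 → ℂ^{n × n}` as a continuous linear map. -/
noncomputable def incl {n : ℕ} (ρ : Mat n) : TangentVec ρ →L[ℝ] Mat n :=
  LinearMap.toContinuousLinearMap (inclLin ρ)

/-! ### Controlled dynamics -/

/-- The space of controls `L²([0,T], ℝ)`. -/
noncomputable abbrev Control (T : ℝ) := Lp ℝ 2 ((volume : Measure ℝ).restrict (Icc 0 T))

/-- `x` is the (absolutely continuous, Carathéodory) solution on `[0,T]` of `x' = F(t, x)` with
`x(t₀) = x₀`: the integral equation `x(t) = x₀ + ∫_{t₀}^t F(s, x(s)) ds`, read entrywise, the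
integrand being integrable on `[0,T]`. -/
def IsSolution {n : ℕ} (T : ℝ) (F : ℝ → Mat n → Mat n) (t₀ : ℝ) (x₀ : Mat n)
    (x : ℝ → Mat n) : Prop :=
  ∀ i j, IntegrableOn (fun s => F s (x s) i j) (Icc 0 T) ∧
    ∀ t ∈ Icc 0 T, x t i j = x₀ i j + ∫ s in t₀..t, F s (x s) i j

section Dynamics

variable {n : ℕ} (H₀ H₁ : su n) {T : ℝ}

/-- `H₀ + u(t) H₁`. -/
noncomputable def hamiltonian (u : Control T) (t : ℝ) : Mat n :=
  (H₀ : Mat n) + u t • (H₁ : Mat n)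

/-- `U' = (H₀ + u H₁) U` on `[0,T]`, `U(0) = Id`. -/
def IsPropagator (u : Control T) (U : ℝ → Mat n) : Prop :=
  IsSolution T (fun t X => hamiltonian H₀ H₁ u t * X) 0 1 U

/-- `ρ' = [H₀ + u H₁, ρ]` on `[0,T]`, `ρ(0) = ρ₀`. -/
def IsTrajectory (ρ₀ : Mat n) (u : Control T) (ρ : ℝ → Mat n) : Prop :=
  IsSolution T (fun t X => ⁅hamiltonian H₀ H₁ u t, X⁆) 0 ρ₀ ρ

/-- The propagator `U(·)` of the control `u`. -/
noncomputable def propagator (u : Control T) : ℝ → Mat n :=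
  Classical.epsilon (IsPropagator H₀ H₁ u)

/-- The trajectory `ρ(·)` of the control `u`. -/
noncomputable def trajectory (ρ₀ : Mat n) (u : Control T) : ℝ → Mat n :=
  Classical.epsilon (IsTrajectory H₀ H₁ ρ₀ u)

/-- The transition matrix `U(t) U(s)†`: as a function of `t`, it solves the propagator equation
with value `Id` at time `s`. -/
noncomputable def transition (u : Control T) (t s : ℝ) : Mat n :=
  propagator H₀ H₁ u t * (propagator H₀ H₁ u s)ᴴ

/-- The end-point map `u ↦ ρ(T)`. -/
noncomputable def endpoint (ρ₀ : Mat n) (u : Control T) : Mat n :=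
  trajectory H₀ H₁ ρ₀ u T

/-- `D` is the differential at `u` of the end-point map, as a map into `T_{ρ(T)} 𝒪`. -/
def IsDEnd (ρ₀ : Mat n) (u : Control T)
    (D : Control T →L[ℝ] TangentVec (endpoint H₀ H₁ ρ₀ u)) : Prop :=
  HasFDerivAt (endpoint H₀ H₁ ρ₀ : Control T → Mat n) ((incl (endpoint H₀ H₁ ρ₀ u)).comp D) u

/-- The differential at `u` of the end-point map, as a map into `T_{ρ(T)} 𝒪`. -/
noncomputable def dEnd (ρ₀ : Mat n) (u : Control T) :
    Control T →L[ℝ] TangentVec (endpoint H₀ H₁ ρ₀ u) :=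
  Classical.epsilon (IsDEnd H₀ H₁ ρ₀ u)

/-- `q` is an adjoint vector along the trajectory of `u`: `q(t) ∈ T_{ρ(t)} 𝒪`,
`q' = [H₀ + u H₁, q]` on `[0,T]` and `q(T) = z`. -/
def IsAdjointVector (ρ₀ : Mat n) (u : Control T) (z : TangentVec (endpoint H₀ H₁ ρ₀ u))
    (q : ∀ t, TangentVec (trajectory H₀ H₁ ρ₀ u t)) : Prop :=
  IsSolution T (fun t X => ⁅hamiltonian H₀ H₁ u t, X⁆) T (incl _ z) (fun t => incl _ (q t))

/-- The adjoint vector with terminal value `z`. -/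
noncomputable def adjointVector (ρ₀ : Mat n) (u : Control T)
    (z : TangentVec (endpoint H₀ H₁ ρ₀ u)) : ∀ t, TangentVec (trajectory H₀ H₁ ρ₀ u t) :=
  Classical.epsilon (IsAdjointVector H₀ H₁ ρ₀ u z)

/-- The tangent vector `[H₁, ρ] = ad_ρ(-H₁)` at `ρ`. -/
noncomputable def controlField (ρ : Mat n) : TangentVec ρ :=
  ⟨⁅(H₁ : Mat n), ρ⁆, -(H₁ : Mat n), neg_mem H₁.2, by
    rw [ad_apply, Ring.lie_def, Ring.lie_def]; noncomm_ring⟩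

/-- The switching function `Φ(t) = ⟨q(t), [H₁, ρ(t)]⟩_{ρ(t)}`. -/
noncomputable def switching (ρ₀ : Mat n) (u : Control T)
    (z : TangentVec (endpoint H₀ H₁ ρ₀ u)) (t : ℝ) : ℝ :=
  inner ℝ (adjointVector H₀ H₁ ρ₀ u z t) (controlField H₁ (trajectory H₀ H₁ ρ₀ u t))

/-! ### Cost functions -/

/-- `J(ρ) = Re tr(ρ θ)`. -/
noncomputable def costOrbit (θ ρ : Mat n) : ℝ := (ρ * θ).trace.re

/-- The Riemannian gradient of `J` on the orbit at `ρ`: the vector of `T_ρ 𝒪` that represents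
the differential `dJ(ρ)`, restricted to `T_ρ 𝒪`, with respect to the metric. -/
noncomputable def gradOrbit (θ ρ : Mat n) : TangentVec ρ :=
  (InnerProductSpace.toDual ℝ (TangentVec ρ)).symm
    ((fderiv ℝ (costOrbit θ) ρ).comp (incl ρ))

/-- The cost function `𝒥(u) = Re tr(End(u) θ)`. -/
noncomputable def cost (ρ₀ θ : Mat n) (u : Control T) : ℝ :=
  costOrbit θ (endpoint H₀ H₁ ρ₀ u)

/-- `u` is a critical point of `𝒥`: `𝒥` is differentiable at `u` and `∇𝒥(u) = 0`. -/
def IsCriticalControl (ρ₀ θ : Mat n) (u : Control T) : Prop :=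
  HasGradientAt (cost H₀ H₁ ρ₀ θ) 0 u

end Dynamics

end QuantumControl

/-! The theorem reduces to one formula for the derivative of the end-point map. The product rule for
absolutely continuous functions shows that multiplying an inhomogeneous equation by U(t)† removes
the drift (`IsPropagator.conjTranspose_mul`). With zero source this gives unitarity and uniqueness
of U. With source v H₁ U it solves the linearized equation, so that dEnd(u)v = [ρ(T), -X], where X
is the integral over [0,T] of v(t) V(t)† H₁ V(t) and V(t) = U(t)U(T)† (`exists_isDEnd`).

Existence and differentiability come from writing the propagator equation as (1 - K(u))X = 1 in a
space of continuous functions. The Volterra operator K(u) is affine in u, and 1 - K(u) is invertible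
because the powers of K(u) decay factorially (`isUnit_one_sub_volterra`). Differentiating the
inverse gives the linearized equation (`exists_solution_hasFDerivAt`).

J is linear, so pairing ∇J with a tangent vector just evaluates J on it. Cyclicity of the trace then
gives ⟨∇J, dEnd(u)v⟩ = ∫ v Ψ with Ψ(t) = Re tr([ρ(T), θ] V(t)† H₁ V(t)) (`inner_gradOrbit_dEnd`).
The metric is invariant under unitary conjugation (`inner_adTangent_conj`), and both ρ and q are
transported by V, so the switching function is Ψ as well (`switching_eq`, `switching_gradOrbit`).

Criticality, the kernel condition and orthogonality are the chain rule and the definition of the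
adjoint. Orthogonality to all v in L² means Ψ = 0 almost everywhere, hence everywhere on [0,T],
since Ψ is continuous and T > 0. Hermiticity of ρ₀ and θ makes the trace real, so its real part
decides whether it vanishes. Conjugation by U(T) links the last two conditions. -/

namespace QuantumControl

/-! ### Primitives of integrable functions -/

section Scalar

/-- The primitive of an integrable vector-valued function is absolutely continuous. -/
lemma absolutelyContinuousOnInterval_add_integral {E : Type*} [NormedAddCommGroup E]
    [NormedSpace ℝ E] {f : ℝ → E} {a b : ℝ} (hab : a ≤ b) (hf : IntegrableOn f (Icc a b)) (c : E) :
    AbsolutelyContinuousOnInterval (fun t => c + ∫ s in a..t, f s) a b := by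
  have hfi : IntervalIntegrable f volume a b :=
    (intervalIntegrable_iff_integrableOn_Icc_of_le hab).2 hf
  have hG := hfi.norm.absolutelyContinuousOnInterval_intervalIntegral (c := a) left_mem_uIcc
  unfold AbsolutelyContinuousOnInterval at hG ⊢
  -- The increments of the primitive of f are bounded by those of the primitive of ‖f‖, for which
  -- absolute continuity is known.
  refine squeeze_zero' (Filter.Eventually.of_forall fun _ => Finset.sum_nonneg fun _ _ =>
    dist_nonneg) ?_ hG
  rw [Filter.eventually_inf_principal]
  filter_upwards with ⟨m, I⟩ hI
  refine Finset.sum_le_sum fun i hi => ?_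
  have hx := (hI.1 i hi).1
  have hy := (hI.1 i hi).2
  have hix := hfi.mono_set (uIcc_subset_uIcc left_mem_uIcc hx)
  have hiy := hfi.mono_set (uIcc_subset_uIcc left_mem_uIcc hy)
  rw [dist_add_left, dist_eq_norm, dist_eq_norm, intervalIntegral.integral_interval_sub_left hix hiy,
    intervalIntegral.integral_interval_sub_left hix.norm hiy.norm]
  exact intervalIntegral.norm_integral_le_abs_integral_norm

lemma continuousOn_of_eq_add_integral {E : Type*} [NormedAddCommGroup E]
    [NormedSpace ℝ E] {f F : ℝ → E} {a b : ℝ} (hf : IntegrableOn f (Icc a b)) {c : E}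
    (hF : ∀ t ∈ Icc a b, F t = c + ∫ s in a..t, f s) : ContinuousOn F (Icc a b) := by
  rcases le_or_gt a b with hab | hab
  · refine ContinuousOn.congr ?_ hF
    have := intervalIntegral.continuousOn_primitive_interval (μ := volume) (a := a) (b := b)
      (f := f) (by rwa [uIcc_of_le hab])
    rw [uIcc_of_le hab] at this
    exact continuousOn_const.add this
  · simp [Icc_eq_empty_of_lt hab]

/-- The product rule for primitives of integrable complex functions. -/
lemma mul_eq_add_integral {f g F G : ℝ → ℂ} {a b : ℝ} (hab : a ≤ b) {c d : ℂ}
    (hf : IntegrableOn f (Icc a b)) (hg : IntegrableOn g (Icc a b))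
    (hF : ∀ t ∈ Icc a b, F t = c + ∫ s in a..t, f s)
    (hG : ∀ t ∈ Icc a b, G t = d + ∫ s in a..t, g s) :
    IntegrableOn (fun s => f s * G s) (Icc a b) ∧ IntegrableOn (fun s => F s * g s) (Icc a b) ∧
    ∀ t ∈ Icc a b, F t * G t = c * d + ∫ s in a..t, (f s * G s + F s * g s) := by
  have hFc := continuousOn_of_eq_add_integral hf hF
  have hGc := continuousOn_of_eq_add_integral hg hG
  have hi1 : IntegrableOn (fun s => f s * G s) (Icc a b) := hf.mul_continuousOn hGc isCompact_Icc
  have hi2 : IntegrableOn (fun s => F s * g s) (Icc a b) := hg.continuousOn_mul hFc isCompact_Icc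
  refine ⟨hi1, hi2, ?_⟩
  set F' : ℝ → ℂ := fun t => c + ∫ s in a..t, f s with hF'
  set G' : ℝ → ℂ := fun t => d + ∫ s in a..t, g s with hG'
  set h : ℝ → ℂ := fun s => f s * G s + F s * g s with hh
  have hhi : IntegrableOn h (Icc a b) := hi1.add hi2
  have hFa := absolutelyContinuousOnInterval_add_integral hab hf c
  have hGa := absolutelyContinuousOnInterval_add_integral hab hg d
  have hHa := absolutelyContinuousOnInterval_add_integral hab hhi 0
  -- The difference of the two sides is absolutely continuous with derivative zero almost
  -- everywhere, hence constant; its value at a identifies the constant.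
  have key := (hFa.smul hGa).sub hHa
  have hI : ∀ {k : ℝ → ℂ}, IntegrableOn k (Icc a b) → IntervalIntegrable k volume a b :=
    fun hk => (intervalIntegrable_iff_integrableOn_Icc_of_le hab).2 hk
  have hderiv : ∀ᵐ x, x ∈ uIcc a b → HasDerivAt (F' • G' - fun t => 0 + ∫ s in a..t, h s) 0 x := by
    filter_upwards [(hI hf).ae_hasDerivAt_integral, (hI hg).ae_hasDerivAt_integral,
      (hI hhi).ae_hasDerivAt_integral] with x h1 h2 h3 hx
    have hx' : x ∈ Icc a b := by rwa [uIcc_of_le hab] at hx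
    have e1 := (h1 hx a left_mem_uIcc).const_add c
    have e2 := (h2 hx a left_mem_uIcc).const_add d
    have e3 := (h3 hx a left_mem_uIcc).const_add 0
    have e4 := (e1.mul e2).sub e3
    have h0 : f x * (d + ∫ s in a..x, g s) + (c + ∫ s in a..x, f s) * g x - h x = 0 := by
      rw [← hF x hx', ← hG x hx', hh]; ring
    rw [h0] at e4
    exact e4
  obtain ⟨C, hC⟩ := key.const_of_ae_hasDerivAt_zero hderiv
  have hCa := hC a left_mem_uIcc
  simp at hCa
  intro t ht
  have hCt := hC t (by rwa [uIcc_of_le hab])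
  simp at hCt
  rw [hF t ht, hG t ht, hCa]
  linear_combination hCt

end Scalar

/-! ### Calculus of entrywise primitives of matrix-valued functions. -/

section Matrices

variable {n : ℕ} {T : ℝ}

/-- `x` is, on `[0,T]`, the primitive of the entrywise integrable function `f` with value `x₀`
at `t₀`. -/
def IsPrimitive (T : ℝ) (f : ℝ → Mat n) (t₀ : ℝ) (x₀ : Mat n) (x : ℝ → Mat n) : Prop :=
  ∀ i j, IntegrableOn (fun s => f s i j) (Icc 0 T) ∧
    ∀ t ∈ Icc 0 T, x t i j = x₀ i j + ∫ s in t₀..t, f s i j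

namespace IsPrimitive

variable {f g x y : ℝ → Mat n} {t₀ : ℝ} {x₀ y₀ : Mat n}

lemma congr (h : IsPrimitive T f t₀ x₀ x) (ht₀ : t₀ ∈ Icc 0 T) (hfg : EqOn f g (Icc 0 T))
    (hxy : EqOn x y (Icc 0 T)) : IsPrimitive T g t₀ x₀ y := by
  intro i j
  refine ⟨(h i j).1.congr_fun (fun s hs => by simp only [hfg hs]) measurableSet_Icc,
    fun t ht => ?_⟩
  rw [← hxy ht, (h i j).2 t ht]
  congr 1
  refine intervalIntegral.integral_congr fun s hs => ?_
  simp only [hfg (uIcc_subset_Icc ht₀ ht hs)]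

lemma intervalIntegrable (h : IsPrimitive T f t₀ x₀ x) {s t : ℝ} (hs : s ∈ Icc 0 T)
    (ht : t ∈ Icc 0 T) (i j : Fin n) :
    IntervalIntegrable (fun s => f s i j) volume s t :=
  ((h i j).1.mono_set (uIcc_subset_Icc hs ht)).intervalIntegrable

/-- Adjoint vectors are prescribed at time T, while the propagator calculus is based at 0; this
passes between the two. -/
lemma rebase (h : IsPrimitive T f t₀ x₀ x) (ht₀ : t₀ ∈ Icc 0 T) {t₁ : ℝ} (ht₁ : t₁ ∈ Icc 0 T) :
    IsPrimitive T f t₁ (x t₁) x := by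
  refine fun i j => ⟨(h i j).1, fun t ht => ?_⟩
  rw [(h i j).2 t ht, (h i j).2 t₁ ht₁, add_assoc, intervalIntegral.integral_add_adjacent_intervals
    (h.intervalIntegrable ht₀ ht₁ i j) (h.intervalIntegrable ht₁ ht i j)]

lemma apply_base (h : IsPrimitive T f t₀ x₀ x) (ht₀ : t₀ ∈ Icc 0 T) : x t₀ = x₀ := by
  ext i j
  simp [(h i j).2 t₀ ht₀]

/-- Every uniqueness and conservation statement below ends here, once a suitable product has been
shown to have zero derivative. -/
lemma eq_of_zero (h : IsPrimitive T f t₀ x₀ x) (ht₀ : t₀ ∈ Icc 0 T)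
    (hf : ∀ s ∈ Icc 0 T, f s = 0) {t : ℝ} (ht : t ∈ Icc 0 T) : x t = x₀ := by
  ext i j
  have h0 := h.congr ht₀ (g := 0) hf fun _ _ => rfl
  simp [(h0 i j).2 t ht]

lemma const (T t₀ : ℝ) (x₀ : Mat n) : IsPrimitive T 0 t₀ x₀ fun _ => x₀ :=
  fun i j => by simp

lemma continuousOn_apply (h : IsPrimitive T f 0 x₀ x) (i j : Fin n) :
    ContinuousOn (fun t => x t i j) (Icc 0 T) :=
  continuousOn_of_eq_add_integral (h i j).1 (h i j).2

lemma continuousOn (h : IsPrimitive T f 0 x₀ x) : ContinuousOn x (Icc 0 T) :=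
  continuousOn_pi.2 fun i => continuousOn_pi.2 fun j => h.continuousOn_apply i j

lemma conjTranspose (h : IsPrimitive T f t₀ x₀ x) :
    IsPrimitive T (fun s => (f s)ᴴ) t₀ x₀ᴴ fun s => (x s)ᴴ := by
  intro i j
  refine ⟨Complex.conjCLE.toContinuousLinearMap.integrable_comp (h j i).1, fun t ht => ?_⟩
  simp only [Matrix.conjTranspose_apply]
  rw [(h j i).2 t ht, star_add]
  congr 1
  simp only [intervalIntegral]
  rw [star_sub]
  simp only [Complex.star_def, integral_conj]

lemma mul (hT : 0 ≤ T) (hx : IsPrimitive T f 0 x₀ x) (hy : IsPrimitive T g 0 y₀ y) :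
    IsPrimitive T (fun s => f s * y s + x s * g s) 0 (x₀ * y₀) fun s => x s * y s := by
  intro i j
  have key := fun k => mul_eq_add_integral hT (hx i k).1 (hy k j).1 (hx i k).2 (hy k j).2
  have hint : ∀ k, IntegrableOn (fun s => f s i k * y s k j + x s i k * g s k j) (Icc 0 T) :=
    fun k => (key k).1.add (key k).2.1
  have hfun : (fun s => (f s * y s + x s * g s) i j)
      = fun s => ∑ k, (f s i k * y s k j + x s i k * g s k j) := by
    ext s
    simp [Matrix.mul_apply, Finset.sum_add_distrib]
  rw [hfun]
  refine ⟨integrable_finsetSum _ fun k _ => hint k, fun t ht => ?_⟩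
  rw [intervalIntegral.integral_finsetSum fun k _ => ((hint k).mono_set
    (uIcc_subset_Icc ⟨le_rfl, hT⟩ ht)).intervalIntegrable]
  simp only [Matrix.mul_apply, ← Finset.sum_add_distrib]
  exact Finset.sum_congr rfl fun k _ => (key k).2.2 t ht

end IsPrimitive

end Matrices

/-! ### Linear Volterra equations with square integrable coefficients -/

section Volterra

variable {E : Type*} [NormedAddCommGroup E] {T : ℝ}

lemma continuousOn_IccExtend (hT : 0 ≤ T) (X : C(Icc 0 T, E)) (s : Set ℝ) :
    ContinuousOn (IccExtend hT X) s :=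
  X.continuous.Icc_extend'.continuousOn

lemma norm_IccExtend_le (hT : 0 ≤ T) (X : C(Icc 0 T, E)) (s : ℝ) : ‖IccExtend hT X s‖ ≤ ‖X‖ :=
  X.norm_coe_le_norm _

lemma intervalIntegrable_of_mem {f : ℝ → E} (hf : IntegrableOn f (Icc 0 T)) {t : ℝ}
    (ht : t ∈ Icc 0 T) : IntervalIntegrable f volume 0 t :=
  (intervalIntegrable_iff_integrableOn_Icc_of_le ht.1).2
    (hf.mono_set (Icc_subset_Icc_right ht.2))

variable [NormedSpace ℝ E]

lemma integrableOn_control (u : Control T) : IntegrableOn u (Icc 0 T) :=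
  (Lp.memLp u).integrable one_le_two

lemma integrableOn_control_smul (u : Control T) {x : ℝ → E} (hx : ContinuousOn x (Icc 0 T)) :
    IntegrableOn (fun s => u s • x s) (Icc 0 T) :=
  (integrableOn_control u).smul_continuousOn hx isCompact_Icc

lemma integral_control_sq_le (u : Control T) {t : ℝ} (ht : t ∈ Icc 0 T) :
    ∫ s in (0 : ℝ)..t, ‖u s‖ ^ 2 ≤ ‖u‖ ^ 2 := by
  have h2 : ‖u‖ ^ 2 = ∫ s in Icc 0 T, ‖u s‖ ^ 2 := by
    rw [← real_inner_self_eq_norm_sq, L2.inner_def]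
    simp
  rw [h2, intervalIntegral.integral_of_le ht.1]
  refine setIntegral_mono_set ?_ (Filter.Eventually.of_forall fun s => sq_nonneg _) ?_
  · exact (memLp_two_iff_integrable_sq_norm (Lp.aestronglyMeasurable u)).1 (Lp.memLp u)
  · exact (Ioc_subset_Icc_self.trans (Icc_subset_Icc_right ht.2)).eventuallyLE

/-- The Cauchy-Schwarz inequality for `∫ u x` with `u` square integrable. -/
lemma norm_integral_control_smul_sq_le (u : Control T) {x : ℝ → E}
    (hx : ContinuousOn x (Icc 0 T)) {t : ℝ} (ht : t ∈ Icc 0 T) :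
    ‖∫ s in (0 : ℝ)..t, u s • x s‖ ^ 2 ≤ ‖u‖ ^ 2 * ∫ s in (0 : ℝ)..t, ‖x s‖ ^ 2 := by
  have hsub : Ioc 0 t ⊆ Icc 0 T := Ioc_subset_Icc_self.trans (Icc_subset_Icc_right ht.2)
  have hle := Measure.restrict_mono_set (volume : Measure ℝ) hsub
  have hu : MemLp (fun s => ‖u s‖) (ENNReal.ofReal 2) (volume.restrict (Ioc 0 t)) := by
    simpa using ((Lp.memLp u).mono_measure hle).norm
  have hxm : MemLp (fun s => ‖x s‖) (ENNReal.ofReal 2) (volume.restrict (Ioc 0 t)) := by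
    have h1 : MemLp (fun s => ‖x s‖) 2 (volume.restrict (Icc 0 T)) := by
      obtain ⟨C, hC⟩ := isCompact_Icc.exists_bound_of_continuousOn hx.norm
      exact MemLp.of_bound (hx.norm.aestronglyMeasurable measurableSet_Icc) C
        ((ae_restrict_iff' measurableSet_Icc).2 (Filter.Eventually.of_forall hC))
    simpa using h1.mono_measure hle
  have key := integral_mul_le_Lp_mul_Lq_of_nonneg Real.HolderConjugate.two_two
    (Filter.Eventually.of_forall fun s => norm_nonneg (u s))
    (Filter.Eventually.of_forall fun s => norm_nonneg (x s)) hu hxm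
  have h1 : ‖∫ s in (0 : ℝ)..t, u s • x s‖ ≤ ∫ s in Ioc 0 t, ‖u s‖ * ‖x s‖ := by
    rw [intervalIntegral.integral_of_le ht.1]
    refine (norm_integral_le_integral_norm _).trans_eq ?_
    simp only [norm_smul]
  have h2 := h1.trans key
  simp only [Real.rpow_two, ← Real.sqrt_eq_rpow] at h2
  have hA : 0 ≤ ∫ s in Ioc 0 t, ‖u s‖ ^ 2 := integral_nonneg fun s => sq_nonneg _
  have hB : 0 ≤ ∫ s in Ioc 0 t, ‖x s‖ ^ 2 := integral_nonneg fun s => sq_nonneg _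
  have h3 := integral_control_sq_le u ht
  rw [intervalIntegral.integral_of_le ht.1] at h3
  rw [intervalIntegral.integral_of_le (f := fun s => ‖x s‖ ^ 2) ht.1]
  calc ‖∫ s in (0 : ℝ)..t, u s • x s‖ ^ 2
      ≤ (√(∫ s in Ioc 0 t, ‖u s‖ ^ 2) * √(∫ s in Ioc 0 t, ‖x s‖ ^ 2)) ^ 2 :=
        pow_le_pow_left₀ (norm_nonneg _) h2 2
    _ = (∫ s in Ioc 0 t, ‖u s‖ ^ 2) * ∫ s in Ioc 0 t, ‖x s‖ ^ 2 := by
        rw [mul_pow, Real.sq_sqrt hA, Real.sq_sqrt hB]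
    _ ≤ _ := mul_le_mul_of_nonneg_right h3 hB

/-- The continuous function `t ↦ ∫₀ᵗ u X`. -/
noncomputable def weightedPrimitiveFun (hT : 0 ≤ T) (u : Control T) (X : C(Icc 0 T, E)) :
    C(Icc 0 T, E) where
  toFun t := ∫ s in (0 : ℝ)..t, u s • IccExtend hT X s
  continuous_toFun := by
    have h : ContinuousOn (fun t => ∫ s in (0 : ℝ)..t, u s • IccExtend hT X s) (Icc 0 T) :=
      continuousOn_of_eq_add_integral (c := 0)
        (integrableOn_control_smul u (continuousOn_IccExtend hT X _)) (by simp)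
    exact h.comp_continuous continuous_subtype_val Subtype.property

lemma weightedPrimitiveFun_apply (hT : 0 ≤ T) (u : Control T) (X : C(Icc 0 T, E))
    (t : Icc 0 T) :
    weightedPrimitiveFun hT u X t = ∫ s in (0 : ℝ)..t, u s • IccExtend hT X s := rfl

lemma norm_weightedPrimitiveFun_sq_le (hT : 0 ≤ T) (u : Control T) (X : C(Icc 0 T, E))
    (t : Icc 0 T) : ‖weightedPrimitiveFun hT u X t‖ ^ 2
      ≤ ‖u‖ ^ 2 * ∫ s in (0 : ℝ)..t, ‖IccExtend hT X s‖ ^ 2 :=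
  norm_integral_control_smul_sq_le u (continuousOn_IccExtend hT X _) t.2

/-- Linearity in the control holds only almost everywhere for representatives of `Lp` classes; this
puts it in the form that congruence of interval integrals needs. -/
lemma ae_mem_imp_of_ae_restrict {p : ℝ → Prop} (h : ∀ᵐ s ∂volume.restrict (Icc 0 T), p s) {t : ℝ}
    (ht : t ∈ Icc 0 T) : ∀ᵐ s, s ∈ uIoc 0 t → p s := by
  rw [ae_restrict_iff' measurableSet_Icc] at h
  filter_upwards [h] with s hs hst
  rw [uIoc_of_le ht.1] at hst
  exact hs ⟨hst.1.le, hst.2.trans ht.2⟩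

/-- The bilinear map `(u, X) ↦ (t ↦ ∫₀ᵗ u X)`. -/
noncomputable def weightedPrimitive (hT : 0 ≤ T) :
    Control T →L[ℝ] C(Icc 0 T, E) →L[ℝ] C(Icc 0 T, E) :=
  LinearMap.mkContinuous₂
    (LinearMap.mk₂ ℝ (weightedPrimitiveFun hT)
      (fun u v X => by
        ext t
        have hi := fun w : Control T => intervalIntegrable_of_mem
          (integrableOn_control_smul w (continuousOn_IccExtend hT X _)) t.2
        simp only [ContinuousMap.add_apply, weightedPrimitiveFun_apply]
        rw [← intervalIntegral.integral_add (hi u) (hi v)]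
        refine intervalIntegral.integral_congr_ae ?_
        filter_upwards [ae_mem_imp_of_ae_restrict (Lp.coeFn_add u v) t.2] with s hs hst
        rw [hs hst, Pi.add_apply, add_smul])
      (fun c u X => by
        ext t
        simp only [ContinuousMap.smul_apply, weightedPrimitiveFun_apply]
        rw [← intervalIntegral.integral_smul]
        refine intervalIntegral.integral_congr_ae ?_
        filter_upwards [ae_mem_imp_of_ae_restrict (Lp.coeFn_smul c u) t.2] with s hs hst
        rw [hs hst, Pi.smul_apply, smul_assoc])
      (fun u X Y => by
        ext t
        have hi := fun Z : C(Icc 0 T, E) => intervalIntegrable_of_mem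
          (integrableOn_control_smul u (continuousOn_IccExtend hT Z _)) t.2
        simp only [ContinuousMap.add_apply, weightedPrimitiveFun_apply]
        rw [← intervalIntegral.integral_add (hi X) (hi Y)]
        exact intervalIntegral.integral_congr fun s _ => smul_add _ _ _)
      (fun c u X => by
        ext t
        simp only [ContinuousMap.smul_apply, weightedPrimitiveFun_apply]
        rw [← intervalIntegral.integral_smul]
        exact intervalIntegral.integral_congr fun s _ => smul_comm _ _ _))
    (√T) (fun u X => by
      refine (ContinuousMap.norm_le _ (by positivity)).2 fun t => ?_
      refine abs_le_of_sq_le_sq' (?_ : _ ≤ _) (by positivity) |>.2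
      refine (norm_weightedPrimitiveFun_sq_le hT u X t).trans ?_
      have h1 : ∫ s in (0 : ℝ)..t, ‖IccExtend hT X s‖ ^ 2 ≤ ∫ s in (0 : ℝ)..t, ‖X‖ ^ 2 := by
        refine intervalIntegral.integral_mono_on t.2.1 ?_ (by simp) fun s _ => ?_
        · exact ((continuousOn_IccExtend hT X _).norm.pow 2).intervalIntegrable
        · exact pow_le_pow_left₀ (norm_nonneg _) (norm_IccExtend_le hT X s) 2
      have h2 : ∫ s in (0 : ℝ)..t, ‖X‖ ^ 2 ≤ T * ‖X‖ ^ 2 := by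
        simp only [intervalIntegral.integral_const, sub_zero, smul_eq_mul]
        exact mul_le_mul_of_nonneg_right t.2.2 (sq_nonneg _)
      calc _ ≤ ‖u‖ ^ 2 * (T * ‖X‖ ^ 2) :=
            mul_le_mul_of_nonneg_left (h1.trans h2) (sq_nonneg _)
        _ = _ := by rw [mul_pow, mul_pow, Real.sq_sqrt hT]; ring)

lemma weightedPrimitive_apply (hT : 0 ≤ T) (u : Control T) (X : C(Icc 0 T, E)) (t : Icc 0 T) :
    weightedPrimitive hT u X t = ∫ s in (0 : ℝ)..t, u s • IccExtend hT X s := rfl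

/-- The constant control. -/
noncomputable def constControl (T : ℝ) : Control T := (memLp_const (1 : ℝ)).toLp _

/-- The Volterra operator `X ↦ (t ↦ ∫₀ᵗ (A₀ X + u A₁ X))`. -/
noncomputable def volterra (hT : 0 ≤ T) (A₀ A₁ : E →L[ℝ] E) (u : Control T) :
    C(Icc 0 T, E) →L[ℝ] C(Icc 0 T, E) :=
  (weightedPrimitive hT (constControl T)).comp (A₀.compLeftContinuous ℝ (Icc 0 T)) +
    (weightedPrimitive hT u).comp (A₁.compLeftContinuous ℝ (Icc 0 T))

lemma volterra_apply (hT : 0 ≤ T) (A₀ A₁ : E →L[ℝ] E) (u : Control T) (X : C(Icc 0 T, E))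
    (t : Icc 0 T) : volterra hT A₀ A₁ u X t
      = ∫ s in (0 : ℝ)..t, (A₀ (IccExtend hT X s) + u s • A₁ (IccExtend hT X s)) := by
  have hi := fun (w : Control T) (A : E →L[ℝ] E) => intervalIntegrable_of_mem
    (integrableOn_control_smul w (continuousOn_IccExtend hT (A.compLeftContinuous ℝ _ X) _)) t.2
  rw [volterra, add_apply, ContinuousMap.add_apply,
    ContinuousLinearMap.comp_apply, ContinuousLinearMap.comp_apply, weightedPrimitive_apply,
    weightedPrimitive_apply, ← intervalIntegral.integral_add (hi _ A₀) (hi _ A₁)]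
  refine intervalIntegral.integral_congr_ae ?_
  filter_upwards [ae_mem_imp_of_ae_restrict (memLp_const (1 : ℝ)).coeFn_toLp t.2] with s hs hst
  have : constControl T s = 1 := hs hst
  rw [this, one_smul]
  rfl

/-- Cauchy-Schwarz, applied to each of the two weights. Since u is only square integrable, the
estimate that can be iterated is one between squared norms. The drift is treated as a term with
constant weight 1. -/
lemma norm_volterra_sq_le (hT : 0 ≤ T) (A₀ A₁ : E →L[ℝ] E) (u : Control T) (X : C(Icc 0 T, E))
    (t : Icc 0 T) : ‖volterra hT A₀ A₁ u X t‖ ^ 2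
      ≤ (‖constControl T‖ * ‖A₀‖ + ‖u‖ * ‖A₁‖) ^ 2
        * ∫ s in (0 : ℝ)..t, ‖IccExtend hT X s‖ ^ 2 := by
  set I := ∫ s in (0 : ℝ)..t, ‖IccExtend hT X s‖ ^ 2 with hI
  have hI0 : 0 ≤ I := intervalIntegral.integral_nonneg t.2.1 fun s _ => sq_nonneg _
  have key : ∀ (w : Control T) (A : E →L[ℝ] E),
      ‖weightedPrimitive hT w (A.compLeftContinuous ℝ _ X) t‖ ≤ ‖w‖ * ‖A‖ * √I := by
    intro w A
    refine (abs_le_of_sq_le_sq' (?_ : _ ≤ _) (by positivity)).2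
    rw [mul_pow, mul_pow, Real.sq_sqrt hI0, mul_assoc]
    refine (norm_weightedPrimitiveFun_sq_le hT w _ t).trans
      (mul_le_mul_of_nonneg_left ?_ (sq_nonneg _))
    rw [hI, ← intervalIntegral.integral_const_mul]
    refine intervalIntegral.integral_mono_on t.2.1 ?_ ?_ fun s _ => ?_
    · exact ((continuousOn_IccExtend hT _ _).norm.pow 2).intervalIntegrable
    · exact (((continuousOn_IccExtend hT _ _).norm.pow 2).intervalIntegrable).const_mul _
    · rw [← mul_pow]
      exact pow_le_pow_left₀ (norm_nonneg _) (A.le_opNorm _) 2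
  have h1 : ‖volterra hT A₀ A₁ u X t‖ ≤ (‖constControl T‖ * ‖A₀‖ + ‖u‖ * ‖A₁‖) * √I := by
    rw [add_mul]
    exact (norm_add_le _ _).trans (add_le_add (key _ _) (key _ _))
  calc _ ≤ ((‖constControl T‖ * ‖A₀‖ + ‖u‖ * ‖A₁‖) * √I) ^ 2 :=
        pow_le_pow_left₀ (norm_nonneg _) h1 2
    _ = _ := by rw [mul_pow, Real.sq_sqrt hI0]

/-- Iterating the previous bound integrates s^m / m! from 0 to t at each step, which produces the
factorial. -/
lemma norm_volterra_pow_sq_le (hT : 0 ≤ T) (A₀ A₁ : E →L[ℝ] E) (u : Control T)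
    (X : C(Icc 0 T, E)) (m : ℕ) (t : Icc 0 T) : ‖(volterra hT A₀ A₁ u ^ m) X t‖ ^ 2
      ≤ ((‖constControl T‖ * ‖A₀‖ + ‖u‖ * ‖A₁‖) ^ 2) ^ m * ((t : ℝ) ^ m / m.factorial)
        * ‖X‖ ^ 2 := by
  set c := (‖constControl T‖ * ‖A₀‖ + ‖u‖ * ‖A₁‖) ^ 2 with hc
  induction m generalizing t with
  | zero =>
    simpa using pow_le_pow_left₀ (norm_nonneg _) (X.norm_coe_le_norm t) 2
  | succ m ih =>
    rw [pow_succ' (volterra hT A₀ A₁ u), mul_apply_eq_comp]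
    refine (norm_volterra_sq_le hT A₀ A₁ u _ t).trans ?_
    rw [← hc]
    have h1 : ∫ s in (0 : ℝ)..t, ‖IccExtend hT ((volterra hT A₀ A₁ u ^ m) X) s‖ ^ 2
        ≤ ∫ s in (0 : ℝ)..t, (c ^ m * ‖X‖ ^ 2 / m.factorial) * s ^ m := by
      refine intervalIntegral.integral_mono_on t.2.1 ?_ ?_ fun s hs => ?_
      · exact ((continuousOn_IccExtend hT _ _).norm.pow 2).intervalIntegrable
      · exact Continuous.intervalIntegrable (by fun_prop) _ _
      · have hs' : s ∈ Icc 0 T := ⟨hs.1, hs.2.trans t.2.2⟩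
        rw [IccExtend_of_mem hT _ hs']
        refine (ih ⟨s, hs'⟩).trans_eq ?_
        simp only
        ring
    refine (mul_le_mul_of_nonneg_left h1 (sq_nonneg _)).trans_eq ?_
    rw [intervalIntegral.integral_const_mul, integral_pow, Nat.factorial_succ]
    push_cast
    field_simp
    simp
    ring

/-- The operator K itself need not be a contraction, but some power K^m is, so 1 - K^m is invertible
by the Neumann series, and 1 - K divides it. -/
lemma isUnit_one_sub_volterra [CompleteSpace E] (hT : 0 ≤ T) (A₀ A₁ : E →L[ℝ] E)
    (u : Control T) : IsUnit (1 - volterra hT A₀ A₁ u) := by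
  set c := (‖constControl T‖ * ‖A₀‖ + ‖u‖ * ‖A₁‖) ^ 2 with hc
  have hlim := FloorSemiring.tendsto_pow_div_factorial_atTop (c * T)
  -- The threshold is 1/4 because the estimate bounds squared norms; it yields operator norm at most
  -- 1/2.
  obtain ⟨m, hm⟩ := (hlim.eventually (gt_mem_nhds (show (0 : ℝ) < 1 / 4 by norm_num))).exists
  have hnorm : ‖volterra hT A₀ A₁ u ^ m‖ ≤ 1 / 2 := by
    refine ContinuousLinearMap.opNorm_le_bound _ (by norm_num) fun X => ?_
    refine (ContinuousMap.norm_le _ (by positivity)).2 fun t => ?_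
    refine (abs_le_of_sq_le_sq' (?_ : _ ≤ _) (by positivity)).2
    refine (norm_volterra_pow_sq_le hT A₀ A₁ u X m t).trans ?_
    rw [mul_pow]
    refine mul_le_mul_of_nonneg_right ?_ (sq_nonneg _)
    rw [← hc]
    have h1 : (t : ℝ) ^ m ≤ T ^ m := pow_le_pow_left₀ t.2.1 t.2.2 m
    have hc0 : 0 ≤ c := sq_nonneg _
    calc c ^ m * ((t : ℝ) ^ m / m.factorial) ≤ c ^ m * (T ^ m / m.factorial) := by gcongr
      _ = (c * T) ^ m / m.factorial := by rw [mul_pow, mul_div_assoc]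
      _ ≤ (1 / 2) ^ 2 := by norm_num at hm ⊢; exact hm.le
  have hu := isUnit_one_sub_of_norm_lt_one (R := C(Icc 0 T, E) →L[ℝ] C(Icc 0 T, E))
    (hnorm.trans_lt one_half_lt_one)
  -- 1 - K^m is 1 - K times a geometric sum commuting with it, and commuting factors of a unit are
  -- units.
  rw [← mul_neg_geom_sum] at hu
  refine (Commute.isUnit_mul_iff ?_).1 hu |>.1
  rw [commute_iff_eq, mul_neg_geom_sum, geom_sum_mul_neg]

/-- The linear equation `x' = (A₀ + u A₁) x`, `x(0) = x₀`, has a solution that depends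
differentiably on `u`, and the differential solves the linearized equation. -/
theorem exists_solution_hasFDerivAt [CompleteSpace E] (hT : 0 ≤ T) (A₀ A₁ : E →L[ℝ] E) (x₀ : E) :
    ∃ S : Control T → C(Icc 0 T, E),
      (∀ u (t : Icc 0 T), S u t = x₀ +
        ∫ s in (0 : ℝ)..t, (A₀ (IccExtend hT (S u) s) + u s • A₁ (IccExtend hT (S u) s))) ∧
      ∀ u, ∃ D : Control T →L[ℝ] C(Icc 0 T, E), HasFDerivAt S D u ∧
        ∀ v (t : Icc 0 T), D v t =
          (∫ s in (0 : ℝ)..t, (A₀ (IccExtend hT (D v) s) + u s • A₁ (IccExtend hT (D v) s))) +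
            ∫ s in (0 : ℝ)..t, v s • A₁ (IccExtend hT (S u) s) := by
  let K := volterra hT A₀ A₁
  -- P is the linear part of the affine map u ↦ K u, so 1 - K has derivative -P.
  let P : Control T →L[ℝ] C(Icc 0 T, E) →L[ℝ] C(Icc 0 T, E) :=
    ((ContinuousLinearMap.compL ℝ C(Icc 0 T, E) C(Icc 0 T, E) C(Icc 0 T, E)).flip
      (A₁.compLeftContinuous ℝ (Icc 0 T))).comp (weightedPrimitive hT)
  let b : C(Icc 0 T, E) := ContinuousMap.const _ x₀
  let S : Control T → C(Icc 0 T, E) := fun u => Ring.inverse (1 - K u) b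
  have hinv : ∀ u, (1 - K u) * Ring.inverse (1 - K u) = 1 := fun u =>
    Ring.mul_inverse_cancel _ (isUnit_one_sub_volterra hT A₀ A₁ u)
  have hsolve : ∀ u y, Ring.inverse (1 - K u) y = y + K u (Ring.inverse (1 - K u) y) := by
    intro u y
    have h := congrArg (fun L : C(Icc 0 T, E) →L[ℝ] C(Icc 0 T, E) => L y) (hinv u)
    exact sub_eq_iff_eq_add.1 h
  refine ⟨S, fun u t => ?_, fun u => ?_⟩
  · have h := congrArg (fun X : C(Icc 0 T, E) => X t) (hsolve u b)
    refine h.trans ?_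
    rw [ContinuousMap.add_apply, volterra_apply]
    rfl
  · have hK : HasFDerivAt (fun w => 1 - K w) (-P) u :=
      by
      have hKe : K = fun w => (weightedPrimitive hT (constControl T)).comp
          (A₀.compLeftContinuous ℝ (Icc 0 T)) + P w := rfl
      rw [hKe]
      exact (P.hasFDerivAt.const_add _).const_sub (1 : C(Icc 0 T, E) →L[ℝ] C(Icc 0 T, E))
    obtain ⟨U, hU⟩ := isUnit_one_sub_volterra hT A₀ A₁ u
    have hR := hasFDerivAt_ringInverse (𝕜 := ℝ)
      (R := C(Icc 0 T, E) →L[ℝ] C(Icc 0 T, E)) U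
    rw [hU] at hR
    have hI := HasFDerivAt.comp (𝕜 := ℝ) (E := Control T) (F := C(Icc 0 T, E) →L[ℝ] C(Icc 0 T, E))
      (G := C(Icc 0 T, E) →L[ℝ] C(Icc 0 T, E)) (f := fun w => 1 - K w) (f' := -P)
      (g := Ring.inverse) u hR hK
    have hc := (ContinuousLinearMap.apply ℝ C(Icc 0 T, E) b).hasFDerivAt.comp u hI
    have hUi : ((U⁻¹ : (C(Icc 0 T, E) →L[ℝ] C(Icc 0 T, E))ˣ) : C(Icc 0 T, E) →L[ℝ] C(Icc 0 T, E))
        = Ring.inverse (1 - K u) := by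
      rw [← Ring.inverse_unit, hU]
    -- With R = (1 - K u)⁻¹, the derivative of inversion gives -R(-P v)R b = R(P v (S u)); the two
    -- signs cancel. Applying `hsolve` to this vector is then the linearized equation.
    obtain ⟨D, hD, hDv⟩ : ∃ D : Control T →L[ℝ] C(Icc 0 T, E), HasFDerivAt S D u ∧
        ∀ v, D v = Ring.inverse (1 - K u) (P v (S u)) := by
      refine ⟨_, hc, fun v => ?_⟩
      simp [hUi, S]
    refine ⟨D, hD, fun v t => ?_⟩
    have h := congrArg (fun X : C(Icc 0 T, E) => X t) (hsolve u (P v (S u)))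
    rw [← hDv] at h
    refine h.trans ?_
    rw [ContinuousMap.add_apply, volterra_apply, add_comm]
    rfl

end Volterra

/-! ### Propagators and trajectories -/

section LinearFunctional

variable {n : ℕ} {T : ℝ} {f x : ℝ → Mat n} {x₀ : Mat n}

lemma linearMap_eq_sum_single (l : Mat n →ₗ[ℝ] ℝ) (A : Mat n) :
    l A = ∑ i, ∑ j, l (Matrix.single i j (A i j)) := by
  conv_lhs => rw [Matrix.matrix_eq_sum_single A]
  simp only [map_sum]

/-- Linear functionals commute with integration. -/
lemma IsPrimitive.map (h : IsPrimitive T f 0 x₀ x) (l : Mat n →ₗ[ℝ] ℝ) {t : ℝ}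
    (ht : t ∈ Icc 0 T) : l (x t) = l x₀ + ∫ s in (0 : ℝ)..t, l (f s) := by
  let e : Fin n → Fin n → ℂ →L[ℝ] ℝ := fun i j =>
    LinearMap.toContinuousLinearMap (l.comp (Matrix.singleLinearMap ℝ i j))
  have he : ∀ A, l A = ∑ i, ∑ j, e i j (A i j) := linearMap_eq_sum_single l
  have hi : ∀ i j, IntervalIntegrable (fun s => f s i j) volume 0 t := fun i j =>
    h.intervalIntegrable ⟨le_rfl, ht.1.trans ht.2⟩ ht i j
  have hei : ∀ i j, IntervalIntegrable (fun s => e i j (f s i j)) volume 0 t := fun i j =>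
    ⟨(e i j).integrable_comp (hi i j).1, (e i j).integrable_comp (hi i j).2⟩
  simp only [he]
  have hsum : ∀ i, IntervalIntegrable (fun s => ∑ j, e i j (f s i j)) volume 0 t := fun i => by
    simpa only [Finset.sum_fn] using IntervalIntegrable.sum Finset.univ fun j _ => hei i j
  rw [intervalIntegral.integral_finsetSum fun i _ => hsum i,
    ← Finset.sum_add_distrib]
  refine Finset.sum_congr rfl fun i _ => ?_
  rw [intervalIntegral.integral_finsetSum fun j _ => hei i j, ← Finset.sum_add_distrib]
  refine Finset.sum_congr rfl fun j _ => ?_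
  rw [(e i j).intervalIntegral_comp_comm (hi i j), (h i j).2 t ht, map_add]

/-- Otherwise some linear functional vanishes on p but not at x t, against `IsPrimitive.map`. The
use below is that integrals of curves in 𝔰𝔲(n) stay in 𝔰𝔲(n). -/
lemma IsPrimitive.mem_submodule (h : IsPrimitive T f 0 x₀ x) (p : Submodule ℝ (Mat n))
    (hx₀ : x₀ ∈ p) (hf : ∀ s ∈ Icc 0 T, f s ∈ p) {t : ℝ} (ht : t ∈ Icc 0 T) : x t ∈ p := by
  by_contra hx
  obtain ⟨l, hl, hlp⟩ := Submodule.exists_le_ker_of_notMem hx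
  refine hl ?_
  rw [h.map l ht, LinearMap.mem_ker.1 (hlp hx₀), zero_add]
  refine (intervalIntegral.integral_congr fun s hs => ?_).trans intervalIntegral.integral_zero
  exact hlp (hf s (uIcc_subset_Icc ⟨le_rfl, ht.1.trans ht.2⟩ ht hs))

end LinearFunctional

lemma conj_mem_su {n : ℕ} {V A : Mat n} (hV : Vᴴ * V = 1) (hA : A ∈ su n) :
    V * A * Vᴴ ∈ su n := by
  refine ⟨by simp [hA.1, mul_assoc], ?_⟩
  rw [Matrix.trace_mul_comm, ← mul_assoc, hV, one_mul, hA.2]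

lemma conj_lie {n : ℕ} {V : Mat n} (hV : Vᴴ * V = 1) (A B : Mat n) :
    ⁅V * A * Vᴴ, V * B * Vᴴ⁆ = V * ⁅A, B⁆ * Vᴴ := by
  have h : ∀ C D : Mat n, V * C * Vᴴ * (V * D * Vᴴ) = V * (C * D) * Vᴴ := fun C D => by
    rw [show V * C * Vᴴ * (V * D * Vᴴ) = V * C * (Vᴴ * V) * (D * Vᴴ) by simp only [mul_assoc], hV]
    simp only [mul_assoc, mul_one]
  rw [Ring.lie_def, Ring.lie_def, h, h, mul_sub, sub_mul]

section Dynamics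

variable {n : ℕ} {H₀ H₁ : su n} {T : ℝ} {u : Control T} {U : ℝ → Mat n}

lemma hamiltonian_conjTranspose (H₀ H₁ : su n) (u : Control T) (t : ℝ) :
    (hamiltonian H₀ H₁ u t)ᴴ = -hamiltonian H₀ H₁ u t := by
  simp [hamiltonian, H₀.2.1, H₁.2.1, add_comm]

namespace IsPropagator

/-- Variation of constants. -/
lemma conjTranspose_mul (hU : IsPropagator H₀ H₁ u U) (hT : 0 ≤ T) {w x : ℝ → Mat n} {x₀ : Mat n}
    (hx : IsPrimitive T (fun s => hamiltonian H₀ H₁ u s * x s + w s) 0 x₀ x) :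
    IsPrimitive T (fun s => (U s)ᴴ * w s) 0 x₀ fun s => (U s)ᴴ * x s := by
  have hU' : IsPrimitive T (fun s => hamiltonian H₀ H₁ u s * U s) 0 1 U := hU
  have h := hU'.conjTranspose.mul hT hx
  rw [Matrix.conjTranspose_one, one_mul] at h
  refine h.congr ⟨le_rfl, hT⟩ (fun s _ => ?_) fun s _ => rfl
  simp only [Matrix.conjTranspose_mul, hamiltonian_conjTranspose]
  noncomm_ring

/-- Variation of constants with zero source. Taking V = U gives unitarity; a general V gives
uniqueness. -/
lemma conjTranspose_mul_eq (hU : IsPropagator H₀ H₁ u U) (hT : 0 ≤ T) {V : ℝ → Mat n}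
    (hV : IsPropagator H₀ H₁ u V) {t : ℝ} (ht : t ∈ Icc 0 T) : (U t)ᴴ * V t = 1 := by
  have hV' : IsPrimitive T (fun s => hamiltonian H₀ H₁ u s * V s + 0) 0 1 V := by
    simpa only [add_zero] using! hV
  exact (hU.conjTranspose_mul hT hV').eq_of_zero ⟨le_rfl, hT⟩ (fun s _ => mul_zero _) ht

lemma unitary (hU : IsPropagator H₀ H₁ u U) (hT : 0 ≤ T) {t : ℝ} (ht : t ∈ Icc 0 T) :
    (U t)ᴴ * U t = 1 :=
  hU.conjTranspose_mul_eq hT hU ht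

lemma unitary' (hU : IsPropagator H₀ H₁ u U) (hT : 0 ≤ T) {t : ℝ} (ht : t ∈ Icc 0 T) :
    U t * (U t)ᴴ = 1 :=
  mul_eq_one_comm.1 (hU.unitary hT ht)

lemma eq_of_mem (hU : IsPropagator H₀ H₁ u U) (hT : 0 ≤ T) {V : ℝ → Mat n}
    (hV : IsPropagator H₀ H₁ u V) {t : ℝ} (ht : t ∈ Icc 0 T) : V t = U t := by
  have h := congrArg (U t * ·) (hU.conjTranspose_mul_eq hT hV ht)
  simpa only [← mul_assoc, hU.unitary' hT ht, one_mul, mul_one] using h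

/-- Conjugation by the propagator solves the Liouville-von Neumann equation. -/
lemma conj (hU : IsPropagator H₀ H₁ u U) (hT : 0 ≤ T) (C : Mat n) :
    IsTrajectory H₀ H₁ C u fun s => U s * C * (U s)ᴴ := by
  have hU' : IsPrimitive T (fun s => hamiltonian H₀ H₁ u s * U s) 0 1 U := hU
  have h := (hU'.mul hT (IsPrimitive.const T 0 C)).mul hT hU'.conjTranspose
  rw [Matrix.conjTranspose_one, one_mul, mul_one] at h
  refine IsPrimitive.congr h ⟨le_rfl, hT⟩ (fun s _ => ?_) fun s _ => rfl
  simp only [Matrix.conjTranspose_mul, hamiltonian_conjTranspose, Ring.lie_def, Pi.zero_apply]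
  noncomm_ring

/-- Every solution of the Liouville-von Neumann equation is a conjugation by the propagator. -/
lemma eq_conj (hU : IsPropagator H₀ H₁ u U) (hT : 0 ≤ T) {C : Mat n} {σ : ℝ → Mat n}
    (hσ : IsTrajectory H₀ H₁ C u σ) {t : ℝ} (ht : t ∈ Icc 0 T) : σ t = U t * C * (U t)ᴴ := by
  have hU' : IsPrimitive T (fun s => hamiltonian H₀ H₁ u s * U s) 0 1 U := hU
  have hσ' : IsPrimitive T (fun s => ⁅hamiltonian H₀ H₁ u s, σ s⁆) 0 C σ := hσ
  -- The right-hand half -σH of the commutator is treated as a source: multiplying by U† on the left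
  -- removes Hσ, and by U on the right removes the rest, so U†σU is constant.
  have h1 : IsPrimitive T (fun s => hamiltonian H₀ H₁ u s * σ s
      + (-(σ s * hamiltonian H₀ H₁ u s))) 0 C σ := by
    simpa only [Ring.lie_def, sub_eq_add_neg] using hσ'
  have h2 := (hU.conjTranspose_mul hT h1).mul hT hU'
  rw [mul_one] at h2
  have h3 := h2.eq_of_zero ⟨le_rfl, hT⟩ (fun s _ => by noncomm_ring) ht
  rw [← h3, show U t * ((U t)ᴴ * σ t * U t) * (U t)ᴴ = (U t * (U t)ᴴ) * σ t * (U t * (U t)ᴴ) by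
    simp only [mul_assoc], hU.unitary' hT ht, one_mul, mul_one]

end IsPropagator

/-! ### The Volterra theory applied to matrices with the operator norm. -/

section Existence

open scoped Matrix.Norms.L2Operator

/-- The operator norm makes the matrices a real normed algebra. -/
noncomputable abbrev realNormedAlgebra (n : ℕ) : NormedAlgebra ℝ (Mat n) where
  __ := (inferInstance : Algebra ℝ (Mat n))
  norm_smul_le r A := by
    have h := norm_smul_le (r : ℂ) A
    rw [Complex.norm_real, show (r : ℂ) • A = r • A by ext; simp] at h
    exact h

attribute [local instance] realNormedAlgebra

/-- The operator norm makes the matrices a real normed space. -/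
noncomputable abbrev realNormedSpace (n : ℕ) : NormedSpace ℝ (Mat n) :=
  (realNormedAlgebra n).toNormedSpace

attribute [local instance] realNormedSpace

lemma IsPrimitive.of_integral {f x : ℝ → Mat n} {x₀ : Mat n} (hf : IntegrableOn f (Icc 0 T))
    (hx : ∀ t ∈ Icc 0 T, x t = x₀ + ∫ s in (0 : ℝ)..t, f s) : IsPrimitive T f 0 x₀ x := by
  intro i j
  let e : Mat n →L[ℝ] ℂ := LinearMap.toContinuousLinearMap
    (Matrix.entryLinearMap ℝ ℂ i j)
  refine ⟨e.integrable_comp hf, fun t ht => ?_⟩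
  have h := congrArg e (hx t ht)
  rw [map_add, ← e.intervalIntegral_comp_comm (intervalIntegrable_of_mem hf ht)] at h
  exact h

/-- Propagators exist, and depend differentiably on the control; the differential solves the
linearized equation. -/
lemma exists_propagator_hasFDerivAt (H₀ H₁ : su n) (hT : 0 ≤ T) :
    ∃ S : Control T → ℝ → Mat n, (∀ u, IsPropagator H₀ H₁ u (S u)) ∧
      ∀ u, ∃ D : Control T →L[ℝ] Mat n, HasFDerivAt (fun w => S w T) D u ∧
        ∀ v, ∃ Y : ℝ → Mat n, D v = Y T ∧ IsPrimitive T
          (fun s => hamiltonian H₀ H₁ u s * Y s + v s • ((H₁ : Mat n) * S u s)) 0 0 Y := by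
  obtain ⟨S, hS, hD⟩ := exists_solution_hasFDerivAt (E := Mat n) hT
    (ContinuousLinearMap.mul ℝ (Mat n) H₀) (ContinuousLinearMap.mul ℝ (Mat n) H₁) 1
  have hint : ∀ (X : C(Icc 0 T, Mat n)) (w : Control T) (A : Mat n),
      IntegrableOn (fun s => w s • (A * IccExtend hT X s)) (Icc 0 T) := fun X w A =>
    integrableOn_control_smul w (continuousOn_const.mul (continuousOn_IccExtend hT X _))
  have hint' : ∀ (X : C(Icc 0 T, Mat n)) (w : Control T), IntegrableOn
      (fun s => (H₀ : Mat n) * IccExtend hT X s + w s • ((H₁ : Mat n) * IccExtend hT X s))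
      (Icc 0 T) := fun X w =>
    ((continuousOn_const.mul (continuousOn_IccExtend hT X _)).integrableOn_Icc).add (hint X w _)
  have hham : ∀ (X : C(Icc 0 T, Mat n)) (w : Control T) (s : ℝ),
      (H₀ : Mat n) * IccExtend hT X s + w s • ((H₁ : Mat n) * IccExtend hT X s)
        = hamiltonian H₀ H₁ w s * IccExtend hT X s := fun X w s => by
    rw [hamiltonian, add_mul, smul_mul_assoc]
  refine ⟨fun u => IccExtend hT (S u), fun u => ?_, fun u => ?_⟩
  · change IsPrimitive T (fun s => hamiltonian H₀ H₁ u s * IccExtend hT (S u) s) 0 1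
      (IccExtend hT (S u))
    refine IsPrimitive.of_integral ((hint' (S u) u).congr_fun (fun s _ => hham _ _ s)
      measurableSet_Icc) fun t ht => ?_
    rw [IccExtend_of_mem hT _ ht, hS u ⟨t, ht⟩]
    simp only [ContinuousLinearMap.mul_apply', hham]
  · obtain ⟨D, hDu, hDv⟩ := hD u
    let ev : C(Icc 0 T, Mat n) →L[ℝ] Mat n := ContinuousMap.evalCLM ℝ ⟨T, hT, le_rfl⟩
    refine ⟨ev.comp D, ?_, fun v => ⟨IccExtend hT (D v), ?_, ?_⟩⟩
    · have h := ev.hasFDerivAt.comp u hDu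
      have he : (fun w => IccExtend hT (S w) T) = ev ∘ S := by
        ext1 w
        exact IccExtend_of_mem hT _ ⟨hT, le_rfl⟩
      rw [he]
      exact h
    · exact (IccExtend_of_mem hT _ ⟨hT, le_rfl⟩).symm
    · refine IsPrimitive.of_integral (((hint' (D v) u).congr_fun (fun s _ => hham _ _ s)
        measurableSet_Icc).add (hint (S u) v _)) fun t ht => ?_
      rw [IccExtend_of_mem hT _ ht, hDv v ⟨t, ht⟩]
      simp only [ContinuousLinearMap.mul_apply', hham, zero_add]
      exact (intervalIntegral.integral_add (intervalIntegrable_of_mem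
        ((hint' (D v) u).congr_fun (fun s _ => hham _ _ s) measurableSet_Icc) ht)
        (intervalIntegrable_of_mem (hint (S u) v _) ht)).symm

end Existence

end Dynamics

/-! ### The chosen propagator and trajectory satisfy their equations. -/

section Propagator

variable {n : ℕ} (H₀ H₁ : su n) {T : ℝ} (ρ₀ : Mat n) (u : Control T)

lemma isPropagator_propagator (hT : 0 ≤ T) : IsPropagator H₀ H₁ u (propagator H₀ H₁ u) := by
  obtain ⟨S, hS, -⟩ := exists_propagator_hasFDerivAt H₀ H₁ hT
  exact Classical.epsilon_spec (p := IsPropagator H₀ H₁ u) ⟨S u, hS u⟩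

lemma isTrajectory_trajectory (hT : 0 ≤ T) :
    IsTrajectory H₀ H₁ ρ₀ u (trajectory H₀ H₁ ρ₀ u) :=
  Classical.epsilon_spec (p := IsTrajectory H₀ H₁ ρ₀ u)
    ⟨_, (isPropagator_propagator H₀ H₁ u hT).conj hT ρ₀⟩

lemma trajectory_eq (hT : 0 ≤ T) {t : ℝ} (ht : t ∈ Icc 0 T) : trajectory H₀ H₁ ρ₀ u t
    = propagator H₀ H₁ u t * ρ₀ * (propagator H₀ H₁ u t)ᴴ :=
  (isPropagator_propagator H₀ H₁ u hT).eq_conj hT (isTrajectory_trajectory H₀ H₁ ρ₀ u hT) ht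

lemma endpoint_eq (hT : 0 ≤ T) : endpoint H₀ H₁ ρ₀ u
    = propagator H₀ H₁ u T * ρ₀ * (propagator H₀ H₁ u T)ᴴ :=
  trajectory_eq H₀ H₁ ρ₀ u hT ⟨hT, le_rfl⟩

/-- Conjugation ignores a phase: with c an n-th root of the conjugate of det V, which has modulus 1,
c V has determinant 1. This avoids tracking the determinant along the flow. For n = 0 no root is
needed. -/
lemma conj_mem_orbit {V : Mat n} (hV : Vᴴ * V = 1) (ρ₀ : Mat n) : V * ρ₀ * Vᴴ ∈ orbit ρ₀ := by
  rcases Nat.eq_zero_or_pos n with rfl | hn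
  · exact ⟨1, one_mem _, Subsingleton.elim _ _⟩
  obtain ⟨c, hc⟩ := IsAlgClosed.exists_pow_nat_eq (star V.det) hn
  have hdet : star V.det * V.det = 1 := by
    rw [← Matrix.det_conjTranspose, ← Matrix.det_mul, hV, Matrix.det_one]
  have hnorm : ‖V.det‖ = 1 := by
    have h := congrArg norm hdet
    rw [norm_mul, norm_star, norm_one] at h
    nlinarith [norm_nonneg V.det]
  have hcn : ‖c‖ = 1 := by
    have h := congrArg norm hc
    rw [norm_pow, norm_star, hnorm] at h
    exact (pow_eq_one_iff_of_nonneg (norm_nonneg c) hn.ne').1 h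
  have hcc : star c * c = 1 := by
    rw [Complex.star_def, Complex.conj_mul', hcn]
    simp
  refine ⟨c • V, Matrix.mem_specialUnitaryGroup_iff.2 ⟨Matrix.mem_unitaryGroup_iff'.2 ?_, ?_⟩, ?_⟩
  · rw [Matrix.star_eq_conjTranspose, Matrix.conjTranspose_smul, smul_mul_smul_comm, hcc, hV,
      one_smul]
  · rw [Matrix.det_smul, Fintype.card_fin, hc, hdet]
  · rw [Matrix.conjTranspose_smul, smul_mul_assoc, smul_mul_smul_comm, mul_comm c, hcc, one_smul]

end Propagator

/-! ### The metric -/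

section Metric

variable {n : ℕ}

lemma conj_mem_stab {V : Mat n} (hV : Vᴴ * V = 1) {ρ Ω : Mat n} (hΩ : Ω ∈ stab ρ) :
    V * Ω * Vᴴ ∈ stab (V * ρ * Vᴴ) := by
  refine ⟨conj_mem_su hV hΩ.1, ?_⟩
  have h : ⁅ρ, Ω⁆ = 0 := hΩ.2
  change ad (V * ρ * Vᴴ) (V * Ω * Vᴴ) = 0
  rw [ad_apply, conj_lie hV, h, mul_zero, zero_mul]

lemma hs_conj {V : Mat n} (hV : Vᴴ * V = 1) (A B : Mat n) :
    ((V * A * Vᴴ)ᴴ * (V * B * Vᴴ)).trace = (Aᴴ * B).trace := by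
  have h : (V * A * Vᴴ)ᴴ * (V * B * Vᴴ) = V * (Aᴴ * (Vᴴ * V) * B * Vᴴ) := by
    simp only [Matrix.conjTranspose_mul, Matrix.conjTranspose_conjTranspose, mul_assoc]
  rw [h, hV, mul_one, Matrix.trace_mul_comm, mul_assoc, hV, mul_one]

/-- The metric is invariant under unitary conjugation. -/
lemma inner_adTangent_conj {V : Mat n} (hV : Vᴴ * V = 1) {ρ σ : Mat n} (hσ : σ = V * ρ * Vᴴ)
    {Ω₁ Ω₂ Ω₁' Ω₂' : su n} (h₁ : (Ω₁' : Mat n) = V * Ω₁ * Vᴴ) (h₂ : (Ω₂' : Mat n) = V * Ω₂ * Vᴴ) :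
    inner ℝ (adTangent σ Ω₁') (adTangent σ Ω₂') = inner ℝ (adTangent ρ Ω₁) (adTangent ρ Ω₂) := by
  subst hσ
  obtain ⟨a₁, ha₁, b₁, hb₁, hab₁⟩ := exists_decomp ρ Ω₁.2
  obtain ⟨a₂, ha₂, b₂, hb₂, hab₂⟩ := exists_decomp ρ Ω₂.2
  have key : ∀ {a b Ω : Mat n}, a + b = Ω → V * a * Vᴴ + V * b * Vᴴ = V * Ω * Vᴴ := by
    rintro a b _ rfl
    rw [mul_add, add_mul]
  rw [inner_adTangent ρ Ω₁ Ω₂ ha₁ hb₁ hab₁ ha₂ hb₂ hab₂,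
    inner_adTangent _ Ω₁' Ω₂' (conj_mem_stab hV ha₁) (conj_mem_pSpace hV ρ hb₁)
      ((key hab₁).trans h₁.symm) (conj_mem_stab hV ha₂) (conj_mem_pSpace hV ρ hb₂)
      ((key hab₂).trans h₂.symm), hs_conj hV]

lemma inclLin_injective (ρ : Mat n) : Function.Injective (inclLin ρ) := Subtype.val_injective

lemma incl_injective (ρ : Mat n) : Function.Injective (incl ρ) := Subtype.val_injective

lemma incl_adTangent (ρ : Mat n) (Ω : su n) : incl ρ (adTangent ρ Ω) = ⁅ρ, (Ω : Mat n)⁆ := rfl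

lemma exists_adTangent_eq {ρ : Mat n} (ξ : TangentVec ρ) : ∃ Ω : su n, adTangent ρ Ω = ξ := by
  obtain ⟨ξ, Ω, hΩ, rfl⟩ := ξ
  exact ⟨⟨Ω, hΩ⟩, rfl⟩

lemma controlField_eq (H₁ : su n) (ρ : Mat n) : controlField H₁ ρ = adTangent ρ (-H₁) := by
  refine incl_injective ρ ?_
  rw [incl_adTangent]
  change ⁅(H₁ : Mat n), ρ⁆ = ⁅ρ, -(H₁ : Mat n)⁆
  rw [Ring.lie_def, Ring.lie_def]
  noncomm_ring

end Metric

/-! ### The differential of the end-point map -/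

section Differential

open scoped Matrix.Norms.L2Operator

attribute [local instance] realNormedAlgebra realNormedSpace

variable {n : ℕ}

lemma HasFDerivAt.conj {F : Type*} [NormedAddCommGroup F] [NormedSpace ℝ F] {M : F → Mat n}
    {M' : F →L[ℝ] Mat n} {x : F} (hM : HasFDerivAt M M' x) (C : Mat n) :
    ∃ D : F →L[ℝ] Mat n, HasFDerivAt (fun y => M y * C * (M y)ᴴ) D x ∧
      ∀ v, D v = M x * C * (M' v)ᴴ + M' v * C * (M x)ᴴ := by
  have h1 := hM.mul_const' C
  have h2 := (LinearMap.toContinuousLinearMap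
    (Matrix.conjTransposeLinearEquiv (Fin n) (Fin n) ℝ ℂ).toLinearMap).hasFDerivAt.comp x hM
  exact ⟨_, h1.mul' h2, fun v => rfl⟩

lemma hasFDerivAt_costOrbit (θ ρ : Mat n) :
    ∃ D : Mat n →L[ℝ] ℝ, HasFDerivAt (costOrbit θ) D ρ ∧ ∀ A, D A = costOrbit θ A := by
  let l : Mat n →ₗ[ℝ] ℝ := Complex.reLm.comp
    ((Matrix.traceLinearMap (Fin n) ℝ ℂ).comp (LinearMap.mulRight ℝ θ))
  exact ⟨LinearMap.toContinuousLinearMap l, (LinearMap.toContinuousLinearMap l).hasFDerivAt,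
    fun A => rfl⟩

/-- By Riesz representation the pairing is the differential of J, and J is linear on matrices, so
its differential is J itself. -/
lemma inner_gradOrbit (θ ρ : Mat n) (ξ : TangentVec ρ) :
    inner ℝ (gradOrbit θ ρ) ξ = costOrbit θ (incl ρ ξ) := by
  obtain ⟨D, hD, hDA⟩ := hasFDerivAt_costOrbit θ ρ
  rw [gradOrbit, InnerProductSpace.toDual_symm_apply, ContinuousLinearMap.comp_apply, ← hDA]
  congr 1
  exact hD.fderiv

variable (H₀ H₁ : su n) {T : ℝ} (ρ₀ : Mat n) (u : Control T)

/-- The differential of the end-point map, through the interaction picture: `W` is the primitive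
of `v(t) U(t)† H₁ U(t)`. -/
lemma exists_isDEnd (hT : 0 ≤ T) : ∃ D, IsDEnd H₀ H₁ ρ₀ u D ∧ ∀ v, ∃ W : ℝ → Mat n,
    IsPrimitive T (fun s => v s •
      ((propagator H₀ H₁ u s)ᴴ * (H₁ : Mat n) * propagator H₀ H₁ u s)) 0 0 W ∧
    incl _ (D v) = ⁅endpoint H₀ H₁ ρ₀ u,
      -(propagator H₀ H₁ u T * W T * (propagator H₀ H₁ u T)ᴴ)⁆ := by
  have hTT : T ∈ Icc 0 T := ⟨hT, le_rfl⟩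
  obtain ⟨S, hS, hD⟩ := exists_propagator_hasFDerivAt H₀ H₁ hT
  have hU := isPropagator_propagator H₀ H₁ u hT
  have hSU : ∀ w, ∀ t ∈ Icc 0 T, S w t = propagator H₀ H₁ w t := fun w t ht =>
    (isPropagator_propagator H₀ H₁ w hT).eq_of_mem hT (hS w) ht
  obtain ⟨D, hDu, hDv⟩ := hD u
  obtain ⟨D', hD', hDv'⟩ := HasFDerivAt.conj hDu ρ₀
  have hend : endpoint H₀ H₁ ρ₀ = fun w => S w T * ρ₀ * (S w T)ᴴ := by
    ext1 w
    rw [endpoint_eq H₀ H₁ ρ₀ w hT, hSU w T hTT]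
  set U := propagator H₀ H₁ u with hUdef
  have hform : ∀ v, ∃ W : ℝ → Mat n,
      IsPrimitive T (fun s => v s • ((U s)ᴴ * (H₁ : Mat n) * U s)) 0 0 W ∧
      W T ∈ su n ∧ D' v = ⁅endpoint H₀ H₁ ρ₀ u, -(U T * W T * (U T)ᴴ)⁆ := by
    intro v
    obtain ⟨Y, hDY, hY⟩ := hDv v
    -- W = U†Y, where Y is the variation of the propagator.
    have hW := (hU.conjTranspose_mul hT hY).congr (g := fun s => v s •
      ((U s)ᴴ * (H₁ : Mat n) * U s)) ⟨le_rfl, hT⟩ (fun s hs => by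
        simp only [hSU u s hs, mul_smul_comm, mul_assoc, hUdef]) (fun s _ => rfl)
    have hWsu : (U T)ᴴ * Y T ∈ su n := hW.mem_submodule (su n) (zero_mem _) (fun s hs =>
      (su n).smul_mem _ (by
        simpa using conj_mem_su (V := (U s)ᴴ) (by simpa using hU.unitary' hT hs) H₁.2)) hTT
    refine ⟨_, hW, hWsu, ?_⟩
    have hYT : Y T = U T * ((U T)ᴴ * Y T) := by
      rw [← mul_assoc, hU.unitary' hT hTT, one_mul]
    have hskew := hWsu.1
    rw [hDv', hDY, hSU u T hTT, endpoint_eq H₀ H₁ ρ₀ u hT, ← hUdef]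
    generalize (U T)ᴴ * Y T = W at hYT hskew ⊢
    have hUU := hU.unitary hT hTT
    have e1 : ∀ A B : Mat n, U T * A * (U T)ᴴ * (U T * B * (U T)ᴴ) = U T * A * B * (U T)ᴴ := by
      intro A B
      rw [show U T * A * (U T)ᴴ * (U T * B * (U T)ᴴ) = U T * A * ((U T)ᴴ * U T) * B * (U T)ᴴ by
        simp only [mul_assoc], hUU, mul_one]
    rw [hYT, Matrix.conjTranspose_mul, hskew, Ring.lie_def,
      mul_neg _ (U T * W * (U T)ᴴ), neg_mul (U T * W * (U T)ᴴ), e1, e1]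
    noncomm_ring
  -- A linear left inverse of the inclusion lifts the matrix-valued derivative to the tangent space;
  -- `hrange` shows that nothing is lost, as all its values are tangent.
  obtain ⟨P, hP⟩ := LinearMap.exists_leftInverse_of_injective (inclLin (endpoint H₀ H₁ ρ₀ u))
    (LinearMap.ker_eq_bot.2 (inclLin_injective _))
  let Pc : Mat n →L[ℝ] TangentVec (endpoint H₀ H₁ ρ₀ u) := LinearMap.toContinuousLinearMap P
  have hrange : ∀ v, incl _ (Pc (D' v)) = D' v := by
    intro v
    obtain ⟨W, -, hW, hDW⟩ := hform v
    have hmem : -(U T * W T * (U T)ᴴ) ∈ su n :=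
      neg_mem (conj_mem_su (hU.unitary hT hTT) hW)
    have hx : D' v = inclLin _ (adTangent (endpoint H₀ H₁ ρ₀ u) ⟨_, hmem⟩) := hDW
    rw [hx]
    exact congrArg (inclLin _) (LinearMap.congr_fun hP _)
  refine ⟨Pc.comp D', ?_, fun v => ?_⟩
  · have h : (incl (endpoint H₀ H₁ ρ₀ u)).comp (Pc.comp D') = D' :=
      ContinuousLinearMap.ext hrange
    rw [IsDEnd, h, hend]
    exact hD'
  · obtain ⟨W, hW, -, hDW⟩ := hform v
    exact ⟨W, hW, (hrange v).trans hDW⟩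

lemma IsDEnd.unique {D D' : Control T →L[ℝ] TangentVec (endpoint H₀ H₁ ρ₀ u)}
    (hD : IsDEnd H₀ H₁ ρ₀ u D) (hD' : IsDEnd H₀ H₁ ρ₀ u D') : D = D' := by
  have h := HasFDerivAt.unique hD hD'
  exact ContinuousLinearMap.ext fun v => incl_injective _ (DFunLike.congr_fun h v)

lemma isDEnd_dEnd (hT : 0 ≤ T) : IsDEnd H₀ H₁ ρ₀ u (dEnd H₀ H₁ ρ₀ u) := by
  obtain ⟨D, hD, -⟩ := exists_isDEnd H₀ H₁ ρ₀ u hT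
  exact Classical.epsilon_spec (p := IsDEnd H₀ H₁ ρ₀ u) ⟨D, hD⟩

/-- Chain rule: the derivative of the cost at u sends v to the pairing of ∇J with dEnd(u)v. -/
lemma isCriticalControl_iff (hT : 0 ≤ T) (θ : Mat n) : IsCriticalControl H₀ H₁ ρ₀ θ u ↔
    ∀ v, inner ℝ (gradOrbit θ (endpoint H₀ H₁ ρ₀ u)) (dEnd H₀ H₁ ρ₀ u v) = 0 := by
  obtain ⟨l, hl, hlA⟩ := hasFDerivAt_costOrbit θ (endpoint H₀ H₁ ρ₀ u)
  have hD : HasFDerivAt (endpoint H₀ H₁ ρ₀ : Control T → Mat n)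
    ((incl (endpoint H₀ H₁ ρ₀ u)).comp (dEnd H₀ H₁ ρ₀ u)) u := isDEnd_dEnd H₀ H₁ ρ₀ u hT
  have h : HasFDerivAt (cost H₀ H₁ ρ₀ θ : Control T → ℝ) _ u := hl.comp u hD
  rw [IsCriticalControl, hasGradientAt_iff_hasFDerivAt, map_zero]
  constructor
  · intro h0 v
    rw [inner_gradOrbit, ← hlA]
    exact DFunLike.congr_fun (h.unique h0) v
  · intro hv
    have hz : l.comp ((incl (endpoint H₀ H₁ ρ₀ u)).comp (dEnd H₀ H₁ ρ₀ u)) = 0 := by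
      ext v
      have := hv v
      rw [inner_gradOrbit, ← hlA] at this
      exact this
    rw [hz] at h
    exact h

end Differential

/-! ### Adjoint vectors and the switching function -/

section Adjoint

variable {n : ℕ} (H₀ H₁ : su n) {T : ℝ} (ρ₀ : Mat n) (u : Control T)

lemma transition_unitary (hT : 0 ≤ T) {s t : ℝ} (hs : s ∈ Icc 0 T) (ht : t ∈ Icc 0 T) :
    (transition H₀ H₁ u t s)ᴴ * transition H₀ H₁ u t s = 1 := by
  have hU := isPropagator_propagator H₀ H₁ u hT
  rw [transition, Matrix.conjTranspose_mul, Matrix.conjTranspose_conjTranspose, mul_assoc,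
    ← mul_assoc _ _ (propagator H₀ H₁ u s)ᴴ, hU.unitary hT ht, one_mul, hU.unitary' hT hs]

lemma trajectory_eq_transition (hT : 0 ≤ T) {t : ℝ} (ht : t ∈ Icc 0 T) :
    trajectory H₀ H₁ ρ₀ u t = transition H₀ H₁ u t T * endpoint H₀ H₁ ρ₀ u *
      (transition H₀ H₁ u t T)ᴴ := by
  have hU := isPropagator_propagator H₀ H₁ u hT
  have hUU := hU.unitary hT (t := T) ⟨hT, le_rfl⟩
  rw [endpoint_eq H₀ H₁ ρ₀ u hT, trajectory_eq H₀ H₁ ρ₀ u hT ht, transition]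
  generalize propagator H₀ H₁ u T = V at hUU
  generalize propagator H₀ H₁ u t = W
  rw [show W * Vᴴ * (V * ρ₀ * Vᴴ) * (W * Vᴴ)ᴴ = W * (Vᴴ * V) * ρ₀ * (Vᴴ * V) * Wᴴ by
    simp only [Matrix.conjTranspose_mul, Matrix.conjTranspose_conjTranspose, mul_assoc],
    hUU, mul_one, mul_one]

lemma isSolution_conj_transition (hT : 0 ≤ T) (Z : Mat n) :
    IsSolution T (fun t X => ⁅hamiltonian H₀ H₁ u t, X⁆) T Z
      fun t => transition H₀ H₁ u t T * Z * (transition H₀ H₁ u t T)ᴴ := by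
  have hU := isPropagator_propagator H₀ H₁ u hT
  have h0 : (0 : ℝ) ∈ Icc 0 T := ⟨le_rfl, hT⟩
  have hTT : T ∈ Icc 0 T := ⟨hT, le_rfl⟩
  have h : IsPrimitive T _ 0 _ _ :=
    hU.conj hT ((propagator H₀ H₁ u T)ᴴ * Z * propagator H₀ H₁ u T)
  have h1 := h.rebase h0 hTT
  have hfun : ∀ t, propagator H₀ H₁ u t * ((propagator H₀ H₁ u T)ᴴ * Z * propagator H₀ H₁ u T) *
      (propagator H₀ H₁ u t)ᴴ = transition H₀ H₁ u t T * Z * (transition H₀ H₁ u t T)ᴴ := by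
    intro t
    simp only [transition, Matrix.conjTranspose_mul, Matrix.conjTranspose_conjTranspose,
      mul_assoc]
  simp only [hfun] at h1
  have hZ : transition H₀ H₁ u T T * Z * (transition H₀ H₁ u T T)ᴴ = Z := by
    rw [transition, hU.unitary' hT hTT]
    simp
  rw [hZ] at h1
  exact h1

lemma eq_conj_transition (hT : 0 ≤ T) {Z : Mat n} {q : ℝ → Mat n}
    (hq : IsSolution T (fun t X => ⁅hamiltonian H₀ H₁ u t, X⁆) T Z q) {t : ℝ}
    (ht : t ∈ Icc 0 T) : q t = transition H₀ H₁ u t T * Z * (transition H₀ H₁ u t T)ᴴ := by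
  have hU := isPropagator_propagator H₀ H₁ u hT
  have h0 : (0 : ℝ) ∈ Icc 0 T := ⟨le_rfl, hT⟩
  have hTT : T ∈ Icc 0 T := ⟨hT, le_rfl⟩
  have hq' : IsPrimitive T _ T Z q := hq
  have h1 := hq'.rebase hTT h0
  have h2 : ∀ t ∈ Icc 0 T, q t
      = propagator H₀ H₁ u t * q 0 * (propagator H₀ H₁ u t)ᴴ := fun t ht => hU.eq_conj hT h1 ht
  have h3 := h2 T hTT
  rw [hq'.apply_base hTT] at h3
  have hUU := hU.unitary hT hTT
  rw [h2 t ht, h3, transition]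
  generalize propagator H₀ H₁ u T = V at hUU
  generalize propagator H₀ H₁ u t = W
  rw [show W * Vᴴ * (V * q 0 * Vᴴ) * (W * Vᴴ)ᴴ = W * (Vᴴ * V) * q 0 * (Vᴴ * V) * Wᴴ by
    simp only [Matrix.conjTranspose_mul, Matrix.conjTranspose_conjTranspose, mul_assoc],
    hUU, mul_one, mul_one]

variable (z : TangentVec (endpoint H₀ H₁ ρ₀ u))

lemma incl_isAdjointVector (hT : 0 ≤ T) {q : ∀ t, TangentVec (trajectory H₀ H₁ ρ₀ u t)}
    (hq : IsAdjointVector H₀ H₁ ρ₀ u z q) {t : ℝ} (ht : t ∈ Icc 0 T) : incl _ (q t)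
      = transition H₀ H₁ u t T * incl _ z * (transition H₀ H₁ u t T)ᴴ :=
  eq_conj_transition H₀ H₁ u hT hq ht

lemma exists_isAdjointVector (hT : 0 ≤ T) :
    ∃ q, IsAdjointVector H₀ H₁ ρ₀ u z q := by
  obtain ⟨Ω, rfl⟩ := exists_adTangent_eq z
  have hTT : T ∈ Icc 0 T := ⟨hT, le_rfl⟩
  have hV := fun {t : ℝ} (ht : t ∈ Icc 0 T) => transition_unitary H₀ H₁ u hT hTT ht
  classical
  -- The transported vector is V[ρ(T), Ω]V† = [ρ(t), VΩV†], which is tangent at ρ(t). Unitarity of V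
  -- is available only on [0,T], so elsewhere the value is a harmless 0.
  refine ⟨fun t => if ht : t ∈ Icc 0 T then adTangent _ ⟨_, conj_mem_su (hV ht) Ω.2⟩ else 0, ?_⟩
  have h : IsPrimitive T _ T _ _ := isSolution_conj_transition H₀ H₁ u hT
    (incl (endpoint H₀ H₁ ρ₀ u) (adTangent (endpoint H₀ H₁ ρ₀ u) Ω))
  have heq : ∀ t ∈ Icc 0 T, transition H₀ H₁ u t T *
      incl (endpoint H₀ H₁ ρ₀ u) (adTangent (endpoint H₀ H₁ ρ₀ u) Ω) *
      (transition H₀ H₁ u t T)ᴴ = incl (trajectory H₀ H₁ ρ₀ u t) (if ht : t ∈ Icc 0 T then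
        adTangent _ ⟨_, conj_mem_su (hV ht) Ω.2⟩ else 0) := by
    intro t ht
    rw [dif_pos ht, incl_adTangent, incl_adTangent, ← conj_lie (hV ht),
      ← trajectory_eq_transition H₀ H₁ ρ₀ u hT ht]
  exact IsPrimitive.congr h hTT (fun t ht => by simp only [heq t ht]) heq

lemma isAdjointVector_adjointVector (hT : 0 ≤ T) :
    IsAdjointVector H₀ H₁ ρ₀ u z (adjointVector H₀ H₁ ρ₀ u z) :=
  Classical.epsilon_spec (exists_isAdjointVector H₀ H₁ ρ₀ u z hT)

/-- The switching function in terms of the metric at the end-point. -/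
lemma switching_eq (hT : 0 ≤ T) {t : ℝ} (ht : t ∈ Icc 0 T) {Ω : su n}
    (hΩ : (Ω : Mat n) = (transition H₀ H₁ u t T)ᴴ * (H₁ : Mat n) * transition H₀ H₁ u t T) :
    switching H₀ H₁ ρ₀ u z t = inner ℝ z (adTangent (endpoint H₀ H₁ ρ₀ u) (-Ω)) := by
  obtain ⟨Ω', rfl⟩ := exists_adTangent_eq z
  have hTT : T ∈ Icc 0 T := ⟨hT, le_rfl⟩
  have hV := transition_unitary H₀ H₁ u hT hTT ht
  have hV' := mul_eq_one_comm.1 hV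
  have hq : adjointVector H₀ H₁ ρ₀ u (adTangent _ Ω') t
      = adTangent _ ⟨_, conj_mem_su hV Ω'.2⟩ := by
    refine incl_injective _ ?_
    rw [incl_isAdjointVector H₀ H₁ ρ₀ u _ hT (isAdjointVector_adjointVector H₀ H₁ ρ₀ u _ hT) ht,
      incl_adTangent, incl_adTangent, ← conj_lie hV, ← trajectory_eq_transition H₀ H₁ ρ₀ u hT ht]
  rw [switching, hq, controlField_eq]
  refine inner_adTangent_conj hV (trajectory_eq_transition H₀ H₁ ρ₀ u hT ht) rfl ?_
  generalize transition H₀ H₁ u t T = V at hΩ hV'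
  rw [Submodule.coe_neg, Submodule.coe_neg, hΩ, mul_neg, neg_mul,
    show V * (Vᴴ * (H₁ : Mat n) * V) * Vᴴ = V * Vᴴ * (H₁ : Mat n) * (V * Vᴴ) by
      simp only [mul_assoc], hV', one_mul, mul_one]

end Adjoint

/-! ### Critical points -/

section Critical

variable {n : ℕ} {T : ℝ}

/-- Cyclicity of the trace moves the commutator from X to θ. -/
lemma costOrbit_lie_neg (θ ρ X : Mat n) :
    costOrbit θ ⁅ρ, -X⁆ = (⁅ρ, θ⁆ * X).trace.re := by
  have h : (⁅ρ, -X⁆ * θ).trace = (⁅ρ, θ⁆ * X).trace := by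
    have h1 : ⁅ρ, -X⁆ * θ = X * ρ * θ - ρ * X * θ := by rw [Ring.lie_def]; noncomm_ring
    have h2 : ⁅ρ, θ⁆ * X = ρ * θ * X - θ * ρ * X := by rw [Ring.lie_def, sub_mul]
    rw [h1, h2, Matrix.trace_sub, Matrix.trace_sub, Matrix.trace_mul_cycle ρ θ X,
      Matrix.trace_mul_cycle ρ X θ]
  rw [costOrbit, h]

/-- The commutator of Hermitian matrices is skew-Hermitian, and the trace of a product of two
skew-Hermitian matrices is its own conjugate. -/
lemma trace_lie_mul_im {ρ θ X : Mat n} (hρ : ρ.IsHermitian) (hθ : θ.IsHermitian) (hX : Xᴴ = -X) :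
    (⁅ρ, θ⁆ * X).trace.im = 0 := by
  have h : star (⁅ρ, θ⁆ * X).trace = (⁅ρ, θ⁆ * X).trace := by
    have hZ : ⁅ρ, θ⁆ᴴ = -⁅ρ, θ⁆ := by
      rw [Ring.lie_def, Matrix.conjTranspose_sub, Matrix.conjTranspose_mul,
        Matrix.conjTranspose_mul, hρ.eq, hθ.eq, neg_sub]
    rw [← Matrix.trace_conjTranspose, Matrix.conjTranspose_mul, hX, hZ, neg_mul_neg,
      Matrix.trace_mul_comm]
  exact Complex.conj_eq_iff_im.1 h

lemma trace_lie_conj {V : Mat n} (hV : Vᴴ * V = 1) (ρ θ X : Mat n) :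
    (⁅V * ρ * Vᴴ, θ⁆ * (V * X * Vᴴ)).trace = (⁅ρ, Vᴴ * θ * V⁆ * X).trace := by
  have hV' := mul_eq_one_comm.1 hV
  have hθ : θ = V * (Vᴴ * θ * V) * Vᴴ := by
    rw [show V * (Vᴴ * θ * V) * Vᴴ = V * Vᴴ * θ * (V * Vᴴ) by simp only [mul_assoc], hV', one_mul,
      mul_one]
  conv_lhs => rw [hθ]
  rw [conj_lie hV, show ∀ A : Mat n, V * A * Vᴴ * (V * X * Vᴴ) = V * (A * (Vᴴ * V) * X * Vᴴ) from
    fun A => by simp only [mul_assoc], hV, mul_one, Matrix.trace_mul_comm, mul_assoc, hV, mul_one]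

/-- A continuous function that is `L²`-orthogonal to all controls vanishes almost everywhere. -/
lemma ae_eq_zero_iff_forall_integral_control {Ψ : ℝ → ℝ} (hΨ : ContinuousOn Ψ (Icc 0 T)) :
    (∀ᵐ t ∂volume.restrict (Icc 0 T), Ψ t = 0) ↔
      ∀ v : Control T, ∫ t in Icc 0 T, v t * Ψ t = 0 := by
  constructor
  · intro h v
    refine integral_eq_zero_of_ae ?_
    filter_upwards [h] with t ht
    simp [ht]
  · intro h
    have hmem : MemLp Ψ 2 (volume.restrict (Icc 0 T)) := by
      obtain ⟨C, hC⟩ := isCompact_Icc.exists_bound_of_continuousOn hΨ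
      exact MemLp.of_bound (hΨ.aestronglyMeasurable measurableSet_Icc) C
        ((ae_restrict_iff' measurableSet_Icc).2 (Filter.Eventually.of_forall hC))
    -- Ψ is bounded on [0,T], hence itself an admissible control, and serves as the test function.
    have h0 : inner ℝ (hmem.toLp Ψ) (hmem.toLp Ψ) = 0 := by
      rw [L2.inner_def]
      refine (integral_congr_ae ?_).trans (h (hmem.toLp Ψ))
      filter_upwards [hmem.coeFn_toLp] with t ht
      simp [ht, sq]
    filter_upwards [hmem.coeFn_toLp, Lp.coeFn_zero ℝ 2 (volume.restrict (Icc (0 : ℝ) T))]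
      with t ht ht0
    rw [← ht, inner_self_eq_zero.1 h0, ht0, Pi.zero_apply]

lemma forall_mem_Icc_of_ae {Ψ : ℝ → ℝ} (hT : 0 < T) (hΨ : ContinuousOn Ψ (Icc 0 T))
    (h : ∀ᵐ t ∂volume.restrict (Icc 0 T), Ψ t = 0) : ∀ t ∈ Icc 0 T, Ψ t = 0 :=
  Measure.eqOn_Icc_of_ae_eq volume hT.ne h hΨ continuousOn_const

end Critical

/-! ### The real trace function behind all the conditions. -/

section Characterization

variable {n : ℕ} (H₀ H₁ : su n) {T : ℝ} (ρ₀ θ : Mat n) (u : Control T)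

lemma transition_conj (t s : ℝ) :
    (transition H₀ H₁ u t s)ᴴ * (H₁ : Mat n) * transition H₀ H₁ u t s =
      propagator H₀ H₁ u s * ((propagator H₀ H₁ u t)ᴴ * (H₁ : Mat n) * propagator H₀ H₁ u t) *
        (propagator H₀ H₁ u s)ᴴ := by
  simp only [transition, Matrix.conjTranspose_mul, Matrix.conjTranspose_conjTranspose, mul_assoc]

/-- The function `tr([ρ(T), θ] V(t)† H₁ V(t))` of the last characterization, which is real. -/
noncomputable def switchingTrace (t : ℝ) : ℝ :=
  (⁅endpoint H₀ H₁ ρ₀ u, θ⁆ *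
    ((transition H₀ H₁ u t T)ᴴ * (H₁ : Mat n) * transition H₀ H₁ u t T)).trace.re

lemma transition_conj_mem_su (hT : 0 ≤ T) {t : ℝ} (ht : t ∈ Icc 0 T) :
    (transition H₀ H₁ u t T)ᴴ * (H₁ : Mat n) * transition H₀ H₁ u t T ∈ su n := by
  have h := mul_eq_one_comm.1 (transition_unitary H₀ H₁ u hT ⟨hT, le_rfl⟩ ht)
  simpa using conj_mem_su (V := (transition H₀ H₁ u t T)ᴴ) (by simpa using h) H₁.2

lemma switching_gradOrbit (hT : 0 ≤ T) {t : ℝ} (ht : t ∈ Icc 0 T) :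
    switching H₀ H₁ ρ₀ u (gradOrbit θ (endpoint H₀ H₁ ρ₀ u)) t
      = switchingTrace H₀ H₁ ρ₀ θ u t := by
  rw [switching_eq H₀ H₁ ρ₀ u _ hT ht (Ω := ⟨_, transition_conj_mem_su H₀ H₁ u hT ht⟩) rfl,
    inner_gradOrbit, incl_adTangent, Submodule.coe_neg, costOrbit_lie_neg, switchingTrace]

lemma continuousOn_switchingTrace (hT : 0 ≤ T) :
    ContinuousOn (switchingTrace H₀ H₁ ρ₀ θ u) (Icc 0 T) := by
  have hU : IsPrimitive T _ 0 _ _ := isPropagator_propagator H₀ H₁ u hT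
  have hc := hU.continuousOn
  have hre : Continuous fun A : Mat n => (⁅endpoint H₀ H₁ ρ₀ u, θ⁆ *
      (propagator H₀ H₁ u T * (Aᴴ * (H₁ : Mat n) * A) * (propagator H₀ H₁ u T)ᴴ)).trace.re :=
    Complex.continuous_re.comp (Continuous.matrix_trace (continuous_const.mul
      ((continuous_const.mul ((continuous_id.matrix_conjTranspose.mul continuous_const).mul
        continuous_id)).mul continuous_const)))
  refine (hre.comp_continuousOn hc).congr fun t _ => ?_
  rw [switchingTrace, transition_conj]
  rfl

/-- The central identity: `switchingTrace` is the L² representative of the differential of the cost.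
The functional `l` is pulled through the integral defining W, and `transition_conj` absorbs the
conjugation by U(T) into V(t). -/
lemma inner_gradOrbit_dEnd (hT : 0 ≤ T) (v : Control T) :
    inner ℝ (gradOrbit θ (endpoint H₀ H₁ ρ₀ u)) (dEnd H₀ H₁ ρ₀ u v)
      = ∫ t in Icc 0 T, v t * switchingTrace H₀ H₁ ρ₀ θ u t := by
  obtain ⟨D, hD, hDv⟩ := exists_isDEnd H₀ H₁ ρ₀ u hT
  rw [IsDEnd.unique H₀ H₁ ρ₀ u (isDEnd_dEnd H₀ H₁ ρ₀ u hT) hD, inner_gradOrbit]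
  obtain ⟨W, hW, hDW⟩ := hDv v
  let l : Mat n →ₗ[ℝ] ℝ := Complex.reLm.comp ((Matrix.traceLinearMap (Fin n) ℝ ℂ).comp
    ((LinearMap.mulLeft ℝ ⁅endpoint H₀ H₁ ρ₀ u, θ⁆).comp
      ((LinearMap.mulRight ℝ (propagator H₀ H₁ u T)ᴴ).comp
        (LinearMap.mulLeft ℝ (propagator H₀ H₁ u T)))))
  have hl : ∀ A, l A = (⁅endpoint H₀ H₁ ρ₀ u, θ⁆ *
    (propagator H₀ H₁ u T * A * (propagator H₀ H₁ u T)ᴴ)).trace.re := fun A => rfl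
  rw [hDW, costOrbit_lie_neg, ← hl, hW.map l ⟨hT, le_rfl⟩, map_zero, zero_add,
    intervalIntegral.integral_of_le hT, integral_Icc_eq_integral_Ioc]
  refine integral_congr_ae (Filter.Eventually.of_forall fun t => ?_)
  change l (v t • _) = v t * switchingTrace H₀ H₁ ρ₀ θ u t
  rw [map_smul, smul_eq_mul, hl, switchingTrace, transition_conj]

lemma endpoint_isHermitian (hT : 0 ≤ T) (hρ₀ : ρ₀.IsHermitian) :
    (endpoint H₀ H₁ ρ₀ u).IsHermitian := by
  rw [endpoint_eq H₀ H₁ ρ₀ u hT]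
  exact Matrix.isHermitian_mul_mul_conjTranspose _ hρ₀

lemma trace_eq_zero_iff_switchingTrace (hT : 0 ≤ T) (hρ₀ : ρ₀.IsHermitian) (hθ : θ.IsHermitian)
    {t : ℝ} (ht : t ∈ Icc 0 T) :
    (⁅endpoint H₀ H₁ ρ₀ u, θ⁆ *
      ((transition H₀ H₁ u t T)ᴴ * (H₁ : Mat n) * transition H₀ H₁ u t T)).trace = 0 ↔
      switchingTrace H₀ H₁ ρ₀ θ u t = 0 := by
  have him := trace_lie_mul_im (endpoint_isHermitian H₀ H₁ ρ₀ u hT hρ₀) hθ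
    (transition_conj_mem_su H₀ H₁ u hT ht).1
  exact ⟨fun h => by rw [switchingTrace, h, Complex.zero_re], fun h => Complex.ext h him⟩

end Characterization

end QuantumControl

/-! ### The theorem. -/

open QuantumControl in
theorem mainTheorem8 {n : ℕ} (H₀ H₁ : QuantumControl.su n) (ρ₀ θ : Matrix (Fin n) (Fin n) ℂ)
    (hρ₀ : ρ₀.IsHermitian) (hθ : θ.IsHermitian) (T : ℝ) (hT : 0 < T)
    (u : QuantumControl.Control T) :
    -- the trajectory, the propagator, the differential of the end-point map and the adjoint
    -- vectors exist and are uniquely determined on [0,T]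
    (QuantumControl.IsPropagator H₀ H₁ u (QuantumControl.propagator H₀ H₁ u) ∧
      ∀ V, QuantumControl.IsPropagator H₀ H₁ u V →
        Set.EqOn V (QuantumControl.propagator H₀ H₁ u) (Set.Icc 0 T)) ∧
    (QuantumControl.IsTrajectory H₀ H₁ ρ₀ u (QuantumControl.trajectory H₀ H₁ ρ₀ u) ∧
      ∀ σ, QuantumControl.IsTrajectory H₀ H₁ ρ₀ u σ →
        Set.EqOn σ (QuantumControl.trajectory H₀ H₁ ρ₀ u) (Set.Icc 0 T)) ∧
    QuantumControl.endpoint H₀ H₁ ρ₀ u ∈ QuantumControl.orbit ρ₀ ∧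
    (QuantumControl.IsDEnd H₀ H₁ ρ₀ u (QuantumControl.dEnd H₀ H₁ ρ₀ u) ∧
      ∀ D, QuantumControl.IsDEnd H₀ H₁ ρ₀ u D → D = QuantumControl.dEnd H₀ H₁ ρ₀ u) ∧
    (∀ z : QuantumControl.TangentVec (QuantumControl.endpoint H₀ H₁ ρ₀ u),
      QuantumControl.IsAdjointVector H₀ H₁ ρ₀ u z (QuantumControl.adjointVector H₀ H₁ ρ₀ u z) ∧
      ∀ q, QuantumControl.IsAdjointVector H₀ H₁ ρ₀ u z q →
        ∀ t ∈ Set.Icc 0 T, q t = QuantumControl.adjointVector H₀ H₁ ρ₀ u z t) ∧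
    -- the characterizations of critical points
    List.TFAE [
      QuantumControl.IsCriticalControl H₀ H₁ ρ₀ θ u,
      QuantumControl.gradOrbit θ (QuantumControl.endpoint H₀ H₁ ρ₀ u) ∈
        LinearMap.ker (ContinuousLinearMap.adjoint (QuantumControl.dEnd H₀ H₁ ρ₀ u) :
          QuantumControl.TangentVec (QuantumControl.endpoint H₀ H₁ ρ₀ u) →ₗ[ℝ]
            QuantumControl.Control T),
      ∀ v : QuantumControl.Control T,
        inner ℝ (QuantumControl.gradOrbit θ (QuantumControl.endpoint H₀ H₁ ρ₀ u))
          (QuantumControl.dEnd H₀ H₁ ρ₀ u v) = 0,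
      ∀ᵐ t ∂(MeasureTheory.volume.restrict (Set.Icc 0 T)),
        QuantumControl.switching H₀ H₁ ρ₀ u
          (QuantumControl.gradOrbit θ (QuantumControl.endpoint H₀ H₁ ρ₀ u)) t = 0,
      ∀ t ∈ Set.Icc 0 T,
        (⁅ρ₀, (QuantumControl.propagator H₀ H₁ u T)ᴴ * θ * QuantumControl.propagator H₀ H₁ u T⁆ *
          ((QuantumControl.propagator H₀ H₁ u t)ᴴ * (H₁ : Matrix (Fin n) (Fin n) ℂ) *
            QuantumControl.propagator H₀ H₁ u t)).trace = 0,
      ∀ t ∈ Set.Icc 0 T,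
        (⁅QuantumControl.trajectory H₀ H₁ ρ₀ u T, θ⁆ *
          ((QuantumControl.transition H₀ H₁ u t T)ᴴ * (H₁ : Matrix (Fin n) (Fin n) ℂ) *
            QuantumControl.transition H₀ H₁ u t T)).trace = 0] := by
  have hT0 := hT.le
  have hTT : T ∈ Set.Icc 0 T := ⟨hT0, le_rfl⟩
  have hU := isPropagator_propagator H₀ H₁ u hT0
  refine ⟨⟨hU, fun V hV t ht => hU.eq_of_mem hT0 hV ht⟩,
    ⟨isTrajectory_trajectory H₀ H₁ ρ₀ u hT0, fun σ hσ t ht =>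
      (hU.eq_conj hT0 hσ ht).trans (trajectory_eq H₀ H₁ ρ₀ u hT0 ht).symm⟩, ?_,
    ⟨isDEnd_dEnd H₀ H₁ ρ₀ u hT0, fun D hD =>
      hD.unique H₀ H₁ ρ₀ u (isDEnd_dEnd H₀ H₁ ρ₀ u hT0)⟩,
    fun z => ⟨isAdjointVector_adjointVector H₀ H₁ ρ₀ u z hT0, fun q hq t ht =>
      incl_injective _ ((incl_isAdjointVector H₀ H₁ ρ₀ u z hT0 hq ht).trans
        (incl_isAdjointVector H₀ H₁ ρ₀ u z hT0
          (isAdjointVector_adjointVector H₀ H₁ ρ₀ u z hT0) ht).symm)⟩, ?_⟩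
  · rw [endpoint_eq H₀ H₁ ρ₀ u hT0]
    exact conj_mem_orbit (hU.unitary hT0 hTT) ρ₀
  have hc := continuousOn_switchingTrace H₀ H₁ ρ₀ θ u hT0
  tfae_have 1 ↔ 3 := isCriticalControl_iff H₀ H₁ ρ₀ u hT0 θ
  tfae_have 2 ↔ 3 := by
    constructor
    · intro h v
      have h0 : ContinuousLinearMap.adjoint (dEnd H₀ H₁ ρ₀ u)
        (gradOrbit θ (endpoint H₀ H₁ ρ₀ u)) = 0 := h
      rw [← ContinuousLinearMap.adjoint_inner_left, h0, inner_zero_left]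
    · intro h
      have h0 : ContinuousLinearMap.adjoint (dEnd H₀ H₁ ρ₀ u)
          (gradOrbit θ (endpoint H₀ H₁ ρ₀ u)) = 0 := by
        refine ext_inner_right ℝ fun v => ?_
        rw [ContinuousLinearMap.adjoint_inner_left, h v, inner_zero_left]
      exact h0
  have hae : (∀ᵐ t ∂(MeasureTheory.volume.restrict (Set.Icc 0 T)),
      switching H₀ H₁ ρ₀ u (gradOrbit θ (endpoint H₀ H₁ ρ₀ u)) t = 0) ↔
      ∀ᵐ t ∂(MeasureTheory.volume.restrict (Set.Icc 0 T)), switchingTrace H₀ H₁ ρ₀ θ u t = 0 := by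
    refine Filter.eventually_congr ((MeasureTheory.ae_restrict_iff' measurableSet_Icc).2
      (Filter.Eventually.of_forall fun t ht => ?_))
    rw [switching_gradOrbit H₀ H₁ ρ₀ θ u hT0 ht]
  tfae_have 3 ↔ 4 := by
    rw [hae, ae_eq_zero_iff_forall_integral_control hc]
    exact forall_congr' fun v => by rw [inner_gradOrbit_dEnd H₀ H₁ ρ₀ θ u hT0]
  tfae_have 4 ↔ 6 := by
    rw [hae]
    constructor
    · intro h t ht
      exact (trace_eq_zero_iff_switchingTrace H₀ H₁ ρ₀ θ u hT0 hρ₀ hθ ht).2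
        (forall_mem_Icc_of_ae hT hc h t ht)
    · intro h
      refine (MeasureTheory.ae_restrict_iff' measurableSet_Icc).2
        (Filter.Eventually.of_forall fun t ht => ?_)
      exact (trace_eq_zero_iff_switchingTrace H₀ H₁ ρ₀ θ u hT0 hρ₀ hθ ht).1 (h t ht)
  -- The two traces agree for each t: all factors are conjugated by U(T).
  tfae_have 5 ↔ 6 := by
    refine forall₂_congr fun t ht => ?_
    rw [transition_conj, trajectory_eq H₀ H₁ ρ₀ u hT0 hTT,
      trace_lie_conj (hU.unitary hT0 hTT)]
  tfae_finish
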